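/- **Problem.** Let $n\ge 1$, $\lambda>0$, let $f:\mathbb R^n\to\mathbb R$ be continuous, put $\varphi(x)=f(x)+\lambda\|x\|_1$, and suppose that $\varphi$ attains its minimum $\varphi_{\rm low}$. Let $x^0\in\mathbb R^n$ be such that the level set $\{x:\varphi(x)\le\varphi(x^0)\}$ is bounded and $f$ is $C^2$ on an open neighbourhood of it, where $\nabla f$ and $\nabla^2 f$ are Lipschitz with constants $L_g>0$ and $L_H>0$. For $t>0$ write $p_t(x)=\mathrm{prox}_{\frac{\lambda}{t}\|\cdot\|_1}(x-\frac1t\nabla f(x))$ and $\mathcal G_t(x)=t(x-p_t(x))$. For $0<\varepsilon_g,\varepsilon_h<1$ let $S(x)=\mathrm{Diag}(s)$ with $s_i=1$ if $|x_i|>\varepsilon_g^{1/2}$ and $s_i=x_i$ otherwise, let $I(x)=\{i:x_i\ne0\}$, and let $H(x)=S_{I}(\nabla^2 f(x))_{I}S_{I}$. A point $x$ is a *strong $\varepsilon_g$-1o point* if $\|\mathcal G_t(x)\|\le\varepsilon_g$ for some $t>0$; it is a *strong\* $(\varepsilon_g,\varepsilon_h)$-2o point* if moreover $\lambda_{\min}(H(x))\ge-\varepsilon_h$.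 Let $g_i(x)=\partial_if(x)+\lambda$ if $x_i>0$, $g_i(x)=\partial_if(x)-\lambda$ if $x_i<0$, and $g_i(x)=\partial_i f(x)-\min\{\max\{-\lambda,\partial_i f(x)\},\lambda\}$ if $x_i=0$; put $\mathrm{sgn}(r)=1$ for $r\ge 0$ and $-1$ for $r<0$. **Algorithm (HPGNCM).** Parameters $\beta>1$, $\bar\eta\in(0,1)$, $\eta\in(0,\frac12)$, $\theta\in(0,1)$. Start at $x=x^0$ with $t=1$ and repeat: * If $\|\mathcal G_t(x)\|>\varepsilon_g$, find the smallest integer $j\ge0$ with $\varphi(p_{\beta^j}(x))<\varphi(x)-\frac{\bar\eta}{\beta^j}\|\mathcal G_{\beta^j}(x)\|^2$ and replace $(x,t)$ by $(p_{\beta^j}(x),\beta^j)$. * Otherwise call a randomized minimum eigenvalue oracle (MEO) on $H(x)$ with tolerance $\varepsilon_h$. It returns either a certificate that $\lambda_{\min}(H(x))\ge-\varepsilon_h$ or a unit vector $u$ with $u^\top H(x)u\le-\frac12\varepsilon_h$. If it returns a certificate, stop with output $x$. If it returns $u$, let $d_I=-\mathrm{sgn}(g_I^\top S_Iu)\,|u^\top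 H(x)u|\,u$ and $d_i=0$ for $i\notin I$, find the smallest integer $j\ge0$ with $\varphi(x+\theta^jS d)<\varphi(x)-\eta\theta^{2j}\|d\|^3$, and replace $(x,t)$ by $(x+\theta^jSd,\theta^j)$. **Assumption on MEO.** Let $0\le\sigma\le\bar\sigma<1$. At every iteration that calls MEO, conditionally on the past, with probability at least $1-\sigma$ the call uses at most $N:=\min\{n,1+\lceil \mathcal C_{meo}\varepsilon_h^{-1/2}\rceil\}$ Hessian-vector products and does not issue a wrong certificate. Here, if $\sigma>0$, $\mathcal C_{meo}\le A\,(1+\ln(n/\sigma))$ for a constant $A$. **Constants.** Let $c_{pg}=\bar\eta/\max\{\beta L_g/(2-2\bar\eta),1\}$, $c_{nc}=\eta\theta^2\min\{1,9(1-2\eta)^2/L_H^2\}$, $\rho=\dfrac{\varphi(x^0)-\varphi_{\rm low}}{\min\{c_{nc}/8,\,c_{pg}\}}$ and $$K=\big\lceil \rho\,\max\{\varepsilon_g^{-1}\varepsilon_h^{-1},\varepsilon_h^{-3},\varepsilon_g^{-2}\}\big\rceil+1 .$$ The *operations* are the Hessian-vector products used by MEO and the evaluations of $\mathcal G$ (gradient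 evaluations): one evaluation for the test in each iteration and one for each trial index $j$ in a proximal line search. **Claim.** There is a constant $C$ that depends only on $L_g,\beta,\bar\eta,A,\bar\sigma$ (and not on $n,f,\lambda,x^0,\sigma,\varepsilon_g,\varepsilon_h,\eta,\theta,L_H$) such that: * With probability at least $(1-\sigma)^K$, HPGNCM stops at a strong\* $(\varepsilon_g,\varepsilon_h)$-2o point after at most $C\,K\min\{n,\varepsilon_h^{-1/2}\ln(n\sigma^{-1})\}$ operations (for $\sigma=0$ the minimum is read as $n$). * With probability at most $1-(1-\sigma)^K$ it stops at a strong $\varepsilon_g$-1o point that is not a strong\* $(\varepsilon_g,\varepsilon_h)$-2o point. On every run on which each MEO call uses at most $N$ Hessian-vector products, it stops at a strong $\varepsilon_g$-1o point within the operation bound of the first item. * (i) If $\sigma>0$, the first item also holds with the bound $C(1+\rho)\ln(n\sigma^{-1})\max\{\varepsilon_g^{-1}\varepsilon_h^{-3/2},\varepsilon_h^{-7/2},\varepsilon_g^{-2}\varepsilon_h^{-1/2}\}$. * (ii) If $\sigma>0$, $\varepsilon_g=\varepsilon$ and $\varepsilon_h=\varepsilon^\nu$ with $\nu\in(0,\frac23]$,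 it also holds with the bound $C(1+\rho)\ln(n\sigma^{-1})\,\varepsilon^{-(2+\nu/2)}$, in particular with $C(1+\rho)\ln(n\sigma^{-1})\,\varepsilon^{-9/4}$ for $\nu=\frac12$. -/

import Mathlib

noncomputable section

namespace HPGNCM

/-- `ℝⁿ` with the Euclidean norm. -/
abbrev E (n : ℕ) := EuclideanSpace ℝ (Fin n)

/-- The `ℓ₁` norm. -/
def l1norm {n : ℕ} (x : E n) : ℝ := ∑ i, |x i|

/-- The proximal map `prox_h(z) = argmin_p h(p) + ½‖p - z‖²`. -/
def prox {n : ℕ} (h : E n → ℝ) (z : E n) : E n :=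
  Classical.epsilon fun p => ∀ y, h p + 1 / 2 * ‖p - z‖ ^ 2 ≤ h y + 1 / 2 * ‖y - z‖ ^ 2

/-- The sign convention `sgn 0 = 1`. -/
def sgn (r : ℝ) : ℝ := if 0 ≤ r then 1 else -1

/-- The Hessian matrix of `f` at `x`, i.e. the Jacobian matrix of the gradient. -/
def hessian {n : ℕ} (f : E n → ℝ) (x : E n) : Matrix (Fin n) (Fin n) ℝ :=
  Matrix.of fun i j => (fderiv ℝ (gradient f) x (EuclideanSpace.single j 1)) i

/-- `λ_min(H) ≥ c` for a square matrix: every (real) eigenvalue is at least `c`.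
For the empty matrix this holds trivially. -/
def MinEigGE {ι : Type*} [Fintype ι] [DecidableEq ι] (H : Matrix ι ι ℝ) (c : ℝ) : Prop :=
  ∀ a : ℝ, Module.End.HasEigenvalue (Matrix.toLin' H) a → c ≤ a

/-- The smallest index satisfying `Q`, or `none` if there is no such index. -/
def firstIndex (Q : ℕ → Prop) : Option ℕ :=
  open Classical in if ∃ j, Q j then some (sInf {j | Q j}) else none

/-- An instance of the problem `min f(x) + lam ‖x‖₁` with starting point `x0`, together with the
tolerances and parameters of the algorithm. -/
structure Setup (n : ℕ) where
  f : E n → ℝ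
  lam : ℝ
  x0 : E n
  εg : ℝ
  εh : ℝ
  β : ℝ
  ηbar : ℝ
  η : ℝ
  θ : ℝ

/-- State of the algorithm: running at the iterate `x` with current parameter `t`,
stopped with output `x`, or caught in an endless line search. -/
inductive State (n : ℕ) where
  | running (x : E n) (t : ℝ)
  | stopped (x : E n)
  | diverged

/-- Response of the minimum eigenvalue oracle: `vec = none` is the certificate
`λ_min ≥ -εh`, `vec = some u` is a direction (only the entries of `u` on the support of the current
iterate are used); `hvp` is the number of Hessian-vector products spent. -/
structure Response (n : ℕ) where
  vec : Option (E n)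
  hvp : ℕ

/-- The event `S` has probability at least `p`: it contains a measurable event of probability at
least `p`. For measurable `S` this says `p ≤ μ S`. -/
def ProbGE {Ω : Type*} {mΩ : MeasurableSpace Ω} (μ : MeasureTheory.Measure Ω) (S : Set Ω)
    (p : ℝ) : Prop :=
  ∃ T : Set Ω, MeasurableSet T ∧ T ⊆ S ∧ p ≤ μ.real T

namespace Setup

variable {n : ℕ} (P : Setup n)

/-- The ranges of the parameters. -/
structure Admissible : Prop where
  lam_pos : 0 < P.lam
  εg_pos : 0 < P.εg
  εg_lt : P.εg < 1
  εh_pos : 0 < P.εh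
  εh_lt : P.εh < 1
  one_lt_β : 1 < P.β
  ηbar_pos : 0 < P.ηbar
  ηbar_lt : P.ηbar < 1
  η_pos : 0 < P.η
  η_lt : P.η < 1 / 2
  θ_pos : 0 < P.θ
  θ_lt : P.θ < 1

/-- The objective `φ = f + lam ‖·‖₁`. -/
def φ (x : E n) : ℝ := P.f x + P.lam * l1norm x

/-- The level set of the starting point. -/
def levelSet : Set (E n) := {x | P.φ x ≤ P.φ P.x0}

/-- `f` is continuous, the level set of the starting point is bounded, and `f` is twice
continuously differentiable on an open neighbourhood `U` of the level set, where `Lg` and `LH` are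
Lipschitz constants of the gradient and of the Hessian (operator norm). -/
structure Smooth (Lg LH : ℝ) : Prop where
  cont : Continuous P.f
  bdd : Bornology.IsBounded P.levelSet
  Lg_pos : 0 < Lg
  LH_pos : 0 < LH
  nhd : ∃ U : Set (E n), IsOpen U ∧ P.levelSet ⊆ U ∧ ContDiffOn ℝ 2 P.f U ∧
    (∀ x ∈ U, ∀ y ∈ U, ‖gradient P.f x - gradient P.f y‖ ≤ Lg * ‖x - y‖) ∧
    (∀ x ∈ U, ∀ y ∈ U,
      ‖fderiv ℝ (gradient P.f) x - fderiv ℝ (gradient P.f) y‖ ≤ LH * ‖x - y‖)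

/-- The proximal gradient point `prox_{(lam/t)‖·‖₁}(x - (1/t)∇f(x))`. -/
def proxPoint (t : ℝ) (x : E n) : E n :=
  prox (fun y => P.lam / t * l1norm y) (x - (1 / t) • gradient P.f x)

/-- The proximal gradient mapping `𝒢_t(x)`. -/
def G (t : ℝ) (x : E n) : E n := t • (x - P.proxPoint t x)

/-- The minimum-norm subgradient `g(x)`. -/
def g (x : E n) (i : Fin n) : ℝ :=
  if 0 < x i then gradient P.f x i + P.lam
  else if x i < 0 then gradient P.f x i - P.lam
  else gradient P.f x i - min (max (-P.lam) (gradient P.f x i)) P.lam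

/-- The diagonal scaling: `s_i = 1` if `|x_i| > εg^{1/2}`, and `s_i = x_i` otherwise. -/
def s (x : E n) (i : Fin n) : ℝ := if √P.εg < |x i| then 1 else x i

/-- The support `I_{≠0}` of `x`. -/
abbrev Supp (x : E n) := {i : Fin n // x i ≠ 0}

/-- The scaled Hessian `S_{I≠0} (∇²f(x))_{I≠0} S_{I≠0}`. -/
def scaledHessian (x : E n) : Matrix (Supp x) (Supp x) ℝ :=
  Matrix.diagonal (fun i : Supp x => P.s x i) *
    (hessian P.f x).submatrix (fun i : Supp x => i.1) (fun i : Supp x => i.1) *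
    Matrix.diagonal (fun i : Supp x => P.s x i)

/-- Strong `εg`-first-order point. -/
def StrongFirstOrder (x : E n) : Prop := ∃ t : ℝ, 0 < t ∧ ‖P.G t x‖ ≤ P.εg

/-- Strong* `(εg, εh)`-second-order point. -/
def StrongStar (x : E n) : Prop :=
  P.StrongFirstOrder x ∧ MinEigGE (P.scaledHessian x) (-P.εh)

/-- The curvature `uᵀ H u` of the scaled Hessian along (the restriction to the support of) `u`. -/
def curv (x u : E n) : ℝ :=
  (fun i : Supp x => u i) ⬝ᵥ (P.scaledHessian x).mulVec (fun i : Supp x => u i)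

/-- The negative curvature direction `d`, which vanishes off the support of `x`. -/
def dir (x u : E n) : E n :=
  WithLp.toLp 2 fun i =>
    if x i ≠ 0 then
      -(sgn (∑ i : Supp x, P.g x i * P.s x i * u i)) * |P.curv x u| * u i
    else 0

/-- The point `x + τ S d`. -/
def ncPoint (x u : E n) (τ : ℝ) : E n :=
  x + τ • (WithLp.toLp 2 fun i => P.s x i * P.dir x u i : E n)

/-- Acceptance test of the proximal gradient step with `t = β^j`. -/
def ProxTest (x : E n) (j : ℕ) : Prop :=
  P.φ (P.proxPoint (P.β ^ j) x) < P.φ x - P.ηbar / P.β ^ j * ‖P.G (P.β ^ j) x‖ ^ 2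

/-- Acceptance test of the negative curvature step with step length `θ^j`. -/
def NCTest (x u : E n) (j : ℕ) : Prop :=
  P.φ (P.ncPoint x u (P.θ ^ j)) < P.φ x - P.η * P.θ ^ (2 * j) * ‖P.dir x u‖ ^ 3

/-- One iteration of the algorithm; the oracle response `r` is read only in the second phase. -/
def step : State n → Response n → State n
  | .running x t, r =>
    open Classical in
    if P.εg < ‖P.G t x‖ then
      match firstIndex (P.ProxTest x) with
      | some j => .running (P.proxPoint (P.β ^ j) x) (P.β ^ j)
      | none => .diverged
    else
      match r.vec with
      | none => .stopped x
      | some u =>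
        match firstIndex (P.NCTest x u) with
        | some j => .running (P.ncPoint x u (P.θ ^ j)) (P.θ ^ j)
        | none => .diverged
  | .stopped x, _ => .stopped x
  | .diverged, _ => .diverged

/-- Number of evaluations of `𝒢` and Hessian-vector products in one iteration. In the first phase
these are the evaluation of `𝒢_t(x)` and one evaluation of `𝒢_{β^j}(x)` for each trial index; in the
second phase the evaluation of `𝒢_t(x)` and the Hessian-vector products of the oracle. -/
def cost : State n → Response n → ℕ
  | .running x t, r =>
    open Classical in
    if P.εg < ‖P.G t x‖ then
      match firstIndex (P.ProxTest x) with
      | some j => 1 + (j + 1)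
      | none => 1
    else 1 + r.hvp
  | .stopped _, _ => 0
  | .diverged, _ => 0

/-- The trajectory of the algorithm, given the sequence of oracle responses. -/
def traj (r : ℕ → Response n) : ℕ → State n
  | 0 => .running P.x0 1
  | k + 1 => P.step (traj r k) (r k)

/-- The algorithm stops with output `x` after at most `B` operations. -/
def StopsWithin (r : ℕ → Response n) (B : ℝ) (x : E n) : Prop :=
  ∃ m, P.traj r m = .stopped x ∧
    ((∑ k ∈ Finset.range m, P.cost (P.traj r k) (r k) : ℕ) : ℝ) ≤ B

/-- The oracle is called in the given state. -/
def Calls : State n → Prop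
  | .running x t => ‖P.G t x‖ ≤ P.εg
  | .stopped _ => False
  | .diverged => False

/-- A returned direction is a unit vector with curvature at most `-εh/2`. -/
def ValidDirection : State n → Response n → Prop
  | .running x _, r => ∀ u, r.vec = some u →
      ∑ i : Supp x, u i ^ 2 = 1 ∧ P.curv x u ≤ -(P.εh / 2)
  | .stopped _, _ => True
  | .diverged, _ => True

/-- A certificate, if issued, is correct. -/
def CorrectCertificate : State n → Response n → Prop
  | .running x _, r => r.vec = none → MinEigGE (P.scaledHessian x) (-P.εh)
  | .stopped _, _ => True
  | .diverged, _ => True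

/-- The bound `min {n, 1 + ⌈Cmeo εh^{-1/2}⌉}` on Hessian-vector products in one oracle call. -/
def meoBound (Cmeo : ℝ) : ℕ := min n (1 + ⌈Cmeo * P.εh ^ (-(1 / 2) : ℝ)⌉₊)

/-- The assumption on the randomized oracle. `R k` is its response at iteration `k`, and `ℱ k` is the
information available before the call at iteration `k`. A returned direction is always valid. At
every iteration that calls the oracle, conditionally on the past, with probability at least `1 - σ`
the call uses at most `meoBound Cmeo` Hessian-vector products and does not issue a wrong
certificate. -/
structure MEOAssumption {Ω : Type*} {mΩ : MeasurableSpace Ω} (μ : MeasureTheory.Measure Ω)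
    (ℱ : MeasureTheory.Filtration ℕ mΩ) (R : ℕ → Ω → Response n) (σ Cmeo : ℝ) : Prop where
  valid : ∀ k ω, P.Calls (P.traj (R · ω) k) → P.ValidDirection (P.traj (R · ω) k) (R k ω)
  meas_calls : ∀ k, @MeasurableSet Ω (ℱ k) {ω | P.Calls (P.traj (R · ω) k)}
  meas_good : ∀ k, @MeasurableSet Ω (ℱ (k + 1)) {ω | P.Calls (P.traj (R · ω) k) ∧
    (R k ω).hvp ≤ P.meoBound Cmeo ∧ P.CorrectCertificate (P.traj (R · ω) k) (R k ω)}
  prob : ∀ k, ∀ A : Set Ω, @MeasurableSet Ω (ℱ k) A → A ⊆ {ω | P.Calls (P.traj (R · ω) k)} →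
    (1 - σ) * μ.real A ≤ μ.real (A ∩ {ω | P.Calls (P.traj (R · ω) k) ∧
      (R k ω).hvp ≤ P.meoBound Cmeo ∧ P.CorrectCertificate (P.traj (R · ω) k) (R k ω)})

/-- The event that the algorithm stops at a strong* point after at most `B` operations. -/
def success {Ω : Type*} (R : ℕ → Ω → Response n) (B : ℝ) : Set Ω :=
  {ω | ∃ x, P.StopsWithin (R · ω) B x ∧ P.StrongStar x}

/-- The event that the algorithm stops (after any number of operations) at a strong first-order
point that is not a strong* second-order point. -/
def incorrect {Ω : Type*} (R : ℕ → Ω → Response n) : Set Ω :=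
  {ω | ∃ x B, P.StopsWithin (R · ω) B x ∧ P.StrongFirstOrder x ∧ ¬ P.StrongStar x}

/-- The constant of the proximal gradient steps. -/
def cpg (Lg : ℝ) : ℝ := P.ηbar / max (P.β * Lg / (2 - 2 * P.ηbar)) 1

/-- The constant of the negative curvature steps. -/
def cnc (LH : ℝ) : ℝ := P.η * P.θ ^ 2 * min 1 (9 * (1 - 2 * P.η) ^ 2 / LH ^ 2)

/-- `(φ(x⁰) - φ_low) / min {cnc/8, cpg}`. -/
def ratio (Lg LH φlow : ℝ) : ℝ := (P.φ P.x0 - φlow) / min (P.cnc LH / 8) (P.cpg Lg)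

/-- The iteration bound `K`. -/
def K (Lg LH φlow : ℝ) : ℕ :=
  ⌈P.ratio Lg LH φlow * max (max (P.εg⁻¹ * P.εh⁻¹) ((P.εh ^ 3)⁻¹)) ((P.εg ^ 2)⁻¹)⌉₊ + 1

/-- `min {n, εh^{-1/2} ln(n/σ)}`, which is `n` for `σ = 0`, where the logarithm is infinite. -/
def work (σ : ℝ) : ℝ :=
  open Classical in if σ = 0 then n else min (n : ℝ) (P.εh ^ (-(1 / 2) : ℝ) * Real.log (n / σ))

end Setup

end HPGNCM

end

/-! Every step lowers φ by a guaranteed amount, so the budget φ(x⁰) − φ_low limits the number of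
steps. With T = max{βLg/(2−2η̄), 1}, a proximal step gains at least (cpg/T)·εg² (`exists_proxStep`)
and a negative curvature step at least (cnc/8)·min{εgεh, εh³} (`exists_ncStep`). Hence a run has at
most K oracle calls and at most T·K proximal steps (`count_le`). The factor T depends only on Lg, β,
η̄ and goes into C, but the calls must be bounded by K itself, because K is the exponent of 1 − σ.

Since f is smooth only near the level set, the Taylor bounds may be used on a segment only once the
segment is known to stay there. `path_mem_of_nhd` supplies this by a first-exit argument: as long as
the segment lies in the neighbourhood, the decrease estimate puts its endpoint back into the level
set.

The proximal test uses the parameter t left by the preceding step, whereas the step uses β^j. The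
two are compared through monotonicity in t: ‖G_t(x)‖ does not decrease and ‖x − p_t(x)‖ does not
increase.

Along the scaled direction Sd the ℓ₁ norm is linear until a coordinate changes sign, the sign in d
makes the first-order term nonpositive, and the second-order term is −|uᵀHu|³, of the same order as
the cubic Taylor remainder. A short enough step is therefore accepted, and a rejected longer trial
bounds the step length from below.

The bound on calls holds on every run, since returned directions are always valid. Conditioning call
by call (`pow_mul_measureReal_le`) then shows that all calls are good with probability at least (1 −
σ)^K. On that event the final certificate is correct and the budget is kept; incorrect runs lie in
its complement. -/

open Set Filter Topology MeasureTheory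
open scoped RealInnerProductSpace Gradient

namespace HPGNCM

/-! ### Taylor bounds along segments and the first-exit argument -/

section Taylor

variable {F : Type*} [NormedAddCommGroup F] [InnerProductSpace ℝ F] [CompleteSpace F]

/-- Integration of a derivative bound on `[0, a]`. -/
theorem le_of_hasDerivAt_le {u u' B B' : ℝ → ℝ} {a : ℝ} (ha : 0 ≤ a)
    (hu : ∀ s ∈ Icc 0 a, HasDerivAt u (u' s) s) (hB : ∀ s, HasDerivAt B (B' s) s)
    (h0 : u 0 ≤ B 0) (h : ∀ s ∈ Icc 0 a, u' s ≤ B' s) : u a ≤ B a :=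
  image_le_of_deriv_right_le_deriv_boundary
    (fun s hs => (hu s hs).continuousAt.continuousWithinAt)
    (fun s hs => (hu s (Ico_subset_Icc_self hs)).hasDerivWithinAt) h0
    (fun s _ => (hB s).continuousAt.continuousWithinAt)
    (fun s _ => (hB s).hasDerivWithinAt)
    (fun s hs => h s (Ico_subset_Icc_self hs)) (right_mem_Icc.2 ha)

theorem hasDerivAt_comp_line {f : F → ℝ} {x d : F} {s : ℝ}
    (hf : DifferentiableAt ℝ f (x + s • d)) :
    HasDerivAt (fun s : ℝ => f (x + s • d)) ⟪∇ f (x + s • d), d⟫ s := by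
  have hγ : HasDerivAt (fun s : ℝ => x + s • d) d s := by
    simpa using ((hasDerivAt_id s).smul_const d).const_add x
  have := hf.hasFDerivAt.comp_hasDerivAt s hγ
  rwa [inner_gradient_left]

theorem hasDerivAt_inner_gradient_line {f : F → ℝ} {x d : F} {s : ℝ}
    (hf : DifferentiableAt ℝ (∇ f) (x + s • d)) :
    HasDerivAt (fun s : ℝ => ⟪∇ f (x + s • d), d⟫) ⟪fderiv ℝ (∇ f) (x + s • d) d, d⟫ s := by
  have hγ : HasDerivAt (fun s : ℝ => x + s • d) d s := by
    simpa using ((hasDerivAt_id s).smul_const d).const_add x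
  have := (hf.hasFDerivAt.comp_hasDerivAt s hγ).inner ℝ (hasDerivAt_const s d)
  simpa using this

/-- The descent lemma along a segment. -/
theorem le_of_lipschitz_gradient {f : F → ℝ} {U : Set F} {L : ℝ} {x d : F} {a : ℝ} (ha : 0 ≤ a)
    (hf : ∀ y ∈ U, DifferentiableAt ℝ f y)
    (hL : ∀ y ∈ U, ∀ z ∈ U, ‖∇ f y - ∇ f z‖ ≤ L * ‖y - z‖)
    (hU : ∀ s ∈ Icc 0 a, x + s • d ∈ U) :
    f (x + a • d) ≤ f x + a * ⟪∇ f x, d⟫ + L / 2 * a ^ 2 * ‖d‖ ^ 2 := by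
  have hx : x ∈ U := by simpa using hU 0 ⟨le_rfl, ha⟩
  refine le_of_hasDerivAt_le (u := fun s : ℝ => f (x + s • d))
    (B := fun s : ℝ => f x + s * ⟪∇ f x, d⟫ + L / 2 * s ^ 2 * ‖d‖ ^ 2)
    (B' := fun s => ⟪∇ f x, d⟫ + L * s * ‖d‖ ^ 2) ha
    (fun s hs => hasDerivAt_comp_line (hf _ (hU s hs))) (fun s => ?_) (by simp) (fun s hs => ?_)
  · have h1 := ((hasDerivAt_id s).mul_const ⟪∇ f x, d⟫).const_add (f x)
    have h2 := (((hasDerivAt_pow 2 s).const_mul (L / 2)).mul_const (‖d‖ ^ 2))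
    refine (h1.add h2).congr_deriv ?_
    simp only [Nat.cast_ofNat, Nat.reduceSub]
    ring
  · have h1 := real_inner_le_norm (∇ f (x + s • d) - ∇ f x) d
    have h2 := hL _ (hU s hs) _ hx
    rw [add_sub_cancel_left, norm_smul, Real.norm_of_nonneg hs.1] at h2
    rw [inner_sub_left] at h1
    have h3 := mul_le_mul_of_nonneg_right h2 (norm_nonneg d)
    linarith

/-- The second-order Taylor bound along a segment. -/
theorem le_of_lipschitz_hessian {f : F → ℝ} {U : Set F} {L : ℝ} {x d : F} {a : ℝ} (ha : 0 ≤ a)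
    (hf : ∀ y ∈ U, DifferentiableAt ℝ f y) (hf' : ∀ y ∈ U, DifferentiableAt ℝ (∇ f) y)
    (hL : ∀ y ∈ U, ∀ z ∈ U, ‖fderiv ℝ (∇ f) y - fderiv ℝ (∇ f) z‖ ≤ L * ‖y - z‖)
    (hU : ∀ s ∈ Icc 0 a, x + s • d ∈ U) :
    f (x + a • d) ≤ f x + a * ⟪∇ f x, d⟫ + a ^ 2 / 2 * ⟪fderiv ℝ (∇ f) x d, d⟫
      + L / 6 * a ^ 3 * ‖d‖ ^ 3 := by
  have hx : x ∈ U := by simpa using hU 0 ⟨le_rfl, ha⟩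
  have key : ∀ s ∈ Icc 0 a, ⟪∇ f (x + s • d), d⟫ ≤
      ⟪∇ f x, d⟫ + s * ⟪fderiv ℝ (∇ f) x d, d⟫ + L / 2 * s ^ 2 * ‖d‖ ^ 3 := by
    intro b hb
    refine le_of_hasDerivAt_le (u := fun s : ℝ => ⟪∇ f (x + s • d), d⟫)
      (B := fun s : ℝ => ⟪∇ f x, d⟫ + s * ⟪fderiv ℝ (∇ f) x d, d⟫ + L / 2 * s ^ 2 * ‖d‖ ^ 3)
      (B' := fun s => ⟪fderiv ℝ (∇ f) x d, d⟫ + L * s * ‖d‖ ^ 3) hb.1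
      (fun s hs => hasDerivAt_inner_gradient_line (hf' _ (hU s ⟨hs.1, hs.2.trans hb.2⟩)))
      (fun s => ?_) (by simp) (fun s hs => ?_)
    · have h1 := ((hasDerivAt_id s).mul_const ⟪fderiv ℝ (∇ f) x d, d⟫).const_add ⟪∇ f x, d⟫
      have h2 := (((hasDerivAt_pow 2 s).const_mul (L / 2)).mul_const (‖d‖ ^ 3))
      refine (h1.add h2).congr_deriv ?_
      simp only [Nat.cast_ofNat, Nat.reduceSub]
      ring
    · have h1 := real_inner_le_norm ((fderiv ℝ (∇ f) (x + s • d) - fderiv ℝ (∇ f) x) d) d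
      have h2 := hL _ (hU s ⟨hs.1, hs.2.trans hb.2⟩) _ hx
      rw [add_sub_cancel_left, norm_smul, Real.norm_of_nonneg hs.1] at h2
      have h3 := (fderiv ℝ (∇ f) (x + s • d) - fderiv ℝ (∇ f) x).le_of_opNorm_le h2 d
      have h4 := mul_le_mul_of_nonneg_right h3 (norm_nonneg d)
      rw [sub_apply, inner_sub_left] at h1
      rw [sub_apply] at h4
      linarith
  refine le_of_hasDerivAt_le (u := fun s : ℝ => f (x + s • d))
    (B := fun s : ℝ => f x + s * ⟪∇ f x, d⟫ + s ^ 2 / 2 * ⟪fderiv ℝ (∇ f) x d, d⟫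
      + L / 6 * s ^ 3 * ‖d‖ ^ 3)
    (B' := fun s => ⟪∇ f x, d⟫ + s * ⟪fderiv ℝ (∇ f) x d, d⟫ + L / 2 * s ^ 2 * ‖d‖ ^ 3) ha
    (fun s hs => hasDerivAt_comp_line (hf _ (hU s hs))) (fun s => ?_) (by simp) key
  have h1 := ((hasDerivAt_id s).mul_const ⟪∇ f x, d⟫).const_add (f x)
  have h2 := (((hasDerivAt_pow 2 s).div_const 2).mul_const ⟪fderiv ℝ (∇ f) x d, d⟫)
  have h3 := (((hasDerivAt_pow 3 s).const_mul (L / 6)).mul_const (‖d‖ ^ 3))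
  refine ((h1.add h2).add h3).congr_deriv ?_
  simp only [Nat.cast_ofNat, Nat.reduceSub]
  ring

/-- If moving along a path inside a neighbourhood `U` of the closed set `L` keeps the path in `L`,
then the path never leaves `L`. -/
theorem path_mem_of_nhd {X : Type*} [TopologicalSpace X] {L U : Set X} (hL : IsClosed L)
    (hU : IsOpen U) (hLU : L ⊆ U) {γ : ℝ → X} (hγ : Continuous γ) {b : ℝ} (h0 : γ 0 ∈ L)
    (h : ∀ a ∈ Icc 0 b, (∀ s ∈ Icc 0 a, γ s ∈ U) → γ a ∈ L) :
    ∀ a ∈ Icc 0 b, γ a ∈ L := by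
  by_contra! hbad
  obtain ⟨a, ha, haL⟩ := hbad
  set B : Set ℝ := {s | s ∈ Icc 0 b ∧ γ s ∉ L} with hB
  have hne : B.Nonempty := ⟨a, ha, haL⟩
  have hbdd : BddBelow B := ⟨0, fun s hs => hs.1.1⟩
  -- The first exit time. Closedness of `L` keeps `γ t` in `L`.
  set t := sInf B
  have ht0 : 0 ≤ t := le_csInf hne fun s hs => hs.1.1
  have htb : t ≤ b := (csInf_le hbdd ⟨ha, haL⟩).trans ha.2
  have hlt : ∀ s, 0 ≤ s → s < t → γ s ∈ L := by
    intro s hs0 hst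
    by_contra hs
    exact absurd (csInf_le hbdd (show s ∈ B from ⟨⟨hs0, hst.le.trans htb⟩, hs⟩)) (not_le.2 hst)
  have htL : γ t ∈ L := by
    rcases ht0.eq_or_lt with h0t | h0t
    · rwa [← h0t]
    · have hcl : t ∈ closure (Ioo 0 t) := by
        rw [closure_Ioo h0t.ne]; exact ⟨ht0, le_rfl⟩
      exact closure_minimal (fun s hs => hlt s hs.1.le hs.2) (hL.preimage hγ) hcl
  -- The path stays in `U` slightly beyond `t`, so `h` applies at an exit time `s` just after `t`
  -- and contradicts `γ s ∉ L`.
  obtain ⟨ε, hε, hball⟩ := Metric.isOpen_iff.1 (hU.preimage hγ) t (hLU htL)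
  obtain ⟨s, hsB, hst⟩ := exists_lt_of_csInf_lt hne (show t < t + ε by linarith)
  refine hsB.2 (h s hsB.1 fun r hr => ?_)
  rcases lt_or_ge r t with hrt | hrt
  · exact hLU (hlt r hr.1 hrt)
  · refine hball ?_
    rw [Metric.mem_ball, Real.dist_eq, abs_of_nonneg (by linarith)]
    linarith [hr.2]

end Taylor

/-! ### The proximal map of the ℓ₁ norm -/

section Prox

variable {n : ℕ}

theorem l1norm_nonneg (x : E n) : 0 ≤ l1norm x := Finset.sum_nonneg fun _ _ => abs_nonneg _

theorem continuous_l1norm : Continuous (l1norm : E n → ℝ) := by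
  unfold l1norm
  fun_prop

theorem l1norm_segment_le (x y : E n) {a : ℝ} (h0 : 0 ≤ a) (h1 : a ≤ 1) :
    l1norm (x + a • (y - x)) ≤ (1 - a) * l1norm x + a * l1norm y := by
  unfold l1norm
  rw [Finset.mul_sum, Finset.mul_sum, ← Finset.sum_add_distrib]
  refine Finset.sum_le_sum fun i _ => ?_
  have : (x + a • (y - x)) i = (1 - a) * x i + a * y i := by simp; ring
  rw [this]
  refine (abs_add_le _ _).trans ?_
  rw [abs_mul, abs_mul, abs_of_nonneg h0, abs_of_nonneg (sub_nonneg.2 h1)]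

/-- The proximal point is a minimizer. -/
theorem prox_spec {c : ℝ} (hc : 0 ≤ c) (z y : E n) :
    c * l1norm (prox (fun y => c * l1norm y) z)
        + 1 / 2 * ‖prox (fun y => c * l1norm y) z - z‖ ^ 2 ≤
      c * l1norm y + 1 / 2 * ‖y - z‖ ^ 2 := by
  have hex : ∃ p : E n, ∀ y, c * l1norm p + 1 / 2 * ‖p - z‖ ^ 2 ≤
      c * l1norm y + 1 / 2 * ‖y - z‖ ^ 2 := by
    have hcont : Continuous fun p : E n => c * l1norm p + 1 / 2 * ‖p - z‖ ^ 2 := by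
      have := continuous_l1norm (n := n)
      fun_prop
    refine hcont.exists_forall_le_of_isBounded z ?_
    -- Comparison with the value at `z` gives r² ≤ 2c‖z‖₁ for r = ‖p − z‖, and r ≤ (r² + 1)/2 turns
    -- this into a bound on r.
    refine (Metric.isBounded_closedBall (x := z) (r := 2 * (c * l1norm z) + 1)).subset ?_
    intro p hp
    simp only [mem_ofPred_eq, sub_self, norm_zero] at hp
    rw [Metric.mem_closedBall, dist_eq_norm]
    have := mul_nonneg hc (l1norm_nonneg p)
    nlinarith [sq_nonneg (‖p - z‖ - 1)]
  exact Classical.epsilon_spec hex y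

/-- The variational inequality that characterizes the proximal point. -/
theorem prox_variational {c : ℝ} (hc : 0 ≤ c) (z y : E n) :
    c * l1norm (prox (fun y => c * l1norm y) z)
        + ⟪z - prox (fun y => c * l1norm y) z, y - prox (fun y => c * l1norm y) z⟫ ≤
      c * l1norm y := by
  set p := prox (fun y => c * l1norm y) z
  -- Comparison of `p` with a nearby point of the segment towards `y`, divided by `a`; the
  -- inequality follows as a → 0⁺.
  have key : ∀ a ∈ Ioc (0 : ℝ) 1,
      c * l1norm p + ⟪z - p, y - p⟫ - c * l1norm y ≤ a * (1 / 2 * ‖y - p‖ ^ 2) := by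
    intro a ha
    have h1 := prox_spec hc z (p + a • (y - p))
    have h2 := mul_le_mul_of_nonneg_left (l1norm_segment_le p y ha.1.le ha.2) hc
    have h3 : ‖p + a • (y - p) - z‖ ^ 2 =
        ‖p - z‖ ^ 2 - 2 * a * ⟪z - p, y - p⟫ + a ^ 2 * ‖y - p‖ ^ 2 := by
      have : p + a • (y - p) - z = (p - z) + a • (y - p) := by abel
      rw [this, norm_add_sq_real, norm_smul, inner_smul_right, mul_pow, Real.norm_eq_abs, sq_abs,
        ← neg_sub z p, inner_neg_left, norm_neg]
      ring
    change c * l1norm p + 1 / 2 * ‖p - z‖ ^ 2 ≤ _ at h1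
    rw [h3] at h1
    refine le_of_mul_le_mul_left ?_ ha.1
    linarith
  have hlim : Tendsto (fun a : ℝ => a * (1 / 2 * ‖y - p‖ ^ 2)) (𝓝[>] 0) (𝓝 0) := by
    have : Continuous fun a : ℝ => a * (1 / 2 * ‖y - p‖ ^ 2) := by fun_prop
    simpa using (this.tendsto 0).mono_left nhdsWithin_le_nhds
  have := ge_of_tendsto hlim (by
    filter_upwards [Ioc_mem_nhdsGT (zero_lt_one' ℝ)] with a ha using key a ha)
  linarith

end Prox

/-! ### Line search indices, absolute values without sign change, sums over the support -/

theorem exists_firstIndex {Q : ℕ → Prop} (h : ∃ j, Q j) :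
    ∃ j, firstIndex Q = some j ∧ Q j ∧ ∀ i < j, ¬ Q i :=
  ⟨sInf {j | Q j}, by simp only [firstIndex, if_pos h], Nat.sInf_mem h,
    fun _ hi => Nat.notMem_of_lt_sInf hi⟩

theorem abs_add_of_nonneg_left {a b : ℝ} (ha : 0 ≤ a) (h : |b| ≤ |a|) : |a + b| = |a| + b := by
  rw [abs_of_nonneg ha] at h ⊢
  exact abs_of_nonneg (by linarith [neg_abs_le b])

theorem abs_add_of_nonpos_left {a b : ℝ} (ha : a ≤ 0) (h : |b| ≤ |a|) : |a + b| = |a| - b := by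
  rw [abs_of_nonpos ha] at h ⊢
  rw [abs_of_nonpos (by linarith [le_abs_self b])]
  ring

theorem sum_supp {n : ℕ} (x : E n) (F : Fin n → ℝ) (h : ∀ i, x i = 0 → F i = 0) :
    ∑ i : {i : Fin n // x i ≠ 0}, F i = ∑ i, F i := by
  rw [← Fintype.sum_subtype_add_sum_subtype (fun i => x i ≠ 0) F]
  simp only [left_eq_add]
  exact Finset.sum_eq_zero fun i _ => h _ (not_not.1 i.2)

/-! ### Proximal gradient steps -/

namespace Setup

variable {n : ℕ} {P : Setup n}

/-- An upper bound on the proximal parameters that the algorithm uses. -/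
noncomputable def tmax (P : Setup n) (Lg : ℝ) : ℝ := max (P.β * Lg / (2 - 2 * P.ηbar)) 1

theorem one_le_tmax (Lg : ℝ) : 1 ≤ P.tmax Lg := le_max_right _ _

theorem Smooth.continuous_φ {Lg LH : ℝ} (hS : P.Smooth Lg LH) : Continuous P.φ :=
  hS.cont.add (continuous_const.mul continuous_l1norm)

theorem Smooth.isClosed_levelSet {Lg LH : ℝ} (hS : P.Smooth Lg LH) : IsClosed P.levelSet :=
  isClosed_le hS.continuous_φ continuous_const

theorem norm_G {t : ℝ} (ht : 0 < t) (x : E n) : ‖P.G t x‖ = t * ‖x - P.proxPoint t x‖ := by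
  rw [G, norm_smul, Real.norm_of_nonneg ht.le]

theorem proxPoint_variational (hlam : 0 ≤ P.lam) {t : ℝ} (ht : 0 < t) (x y : E n) :
    P.lam * l1norm (P.proxPoint t x)
        + ⟪t • (x - P.proxPoint t x) - ∇ P.f x, y - P.proxPoint t x⟫ ≤ P.lam * l1norm y := by
  have h := prox_variational (div_nonneg hlam ht.le) (x - (1 / t) • ∇ P.f x) y
  change P.lam / t * l1norm (P.proxPoint t x) +
    ⟪x - (1 / t) • ∇ P.f x - P.proxPoint t x, y - P.proxPoint t x⟫ ≤ _ at h
  have h1 := mul_le_mul_of_nonneg_left h ht.le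
  have h2 : t • (x - P.proxPoint t x) - ∇ P.f x
      = t • (x - (1 / t) • ∇ P.f x - P.proxPoint t x) := by
    simp only [smul_sub, smul_smul, mul_one_div_cancel ht.ne', one_smul]
    abel
  rw [h2, inner_smul_left]
  simp only [conj_trivial]
  calc _ = t * (P.lam / t * l1norm (P.proxPoint t x) +
        ⟪x - (1 / t) • ∇ P.f x - P.proxPoint t x, y - P.proxPoint t x⟫) := by field_simp
    _ ≤ _ := h1
    _ = _ := by field_simp

/-- Monotonicity of the subdifferential of the `ℓ₁` norm, for two proximal points. -/
theorem proxPoint_compare (hlam : 0 ≤ P.lam) {t t' : ℝ} (ht : 0 < t) (ht' : 0 < t') (x : E n) :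
    (‖x - P.proxPoint t x‖ - ‖x - P.proxPoint t' x‖) *
      (t * ‖x - P.proxPoint t x‖ - t' * ‖x - P.proxPoint t' x‖) ≤ 0 := by
  have h1 := proxPoint_variational hlam ht x (P.proxPoint t' x)
  have h2 := proxPoint_variational hlam ht' x (P.proxPoint t x)
  set p := P.proxPoint t x
  set p' := P.proxPoint t' x
  have e1 : p' - p = (x - p) - (x - p') := by abel
  have e2 : p - p' = (x - p') - (x - p) := by abel
  rw [e1] at h1
  rw [e2] at h2
  simp only [inner_sub_left (_ • _), inner_smul_left, conj_trivial, inner_sub_right _ (x - p),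
    inner_sub_right _ (x - p'), real_inner_self_eq_norm_sq] at h1 h2
  have h3 := real_inner_le_norm (x - p) (x - p')
  rw [real_inner_comm (x - p) (x - p')] at h2
  -- In the sum of `h1` and `h2` the ℓ₁ terms and the gradients cancel. With u = x − p and u' = x −
  -- p' this leaves t‖u‖² + t'‖u'‖² ≤ (t + t')⟪u, u'⟫, and Cauchy–Schwarz gives the product form.
  have h4 := mul_le_mul_of_nonneg_left h3 (add_pos ht ht').le
  nlinarith

theorem norm_sub_proxPoint_le (hlam : 0 ≤ P.lam) {t t' : ℝ} (ht : 0 < t) (htt : t' ≤ t)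
    (ht' : 0 < t') (x : E n) : ‖x - P.proxPoint t x‖ ≤ ‖x - P.proxPoint t' x‖ := by
  by_contra! hlt
  have h := proxPoint_compare hlam ht ht' x
  have h1 := norm_nonneg (x - P.proxPoint t' x)
  have h2 : t' * ‖x - P.proxPoint t' x‖ < t * ‖x - P.proxPoint t x‖ :=
    (mul_le_mul_of_nonneg_right htt h1).trans_lt (mul_lt_mul_of_pos_left hlt ht)
  exact absurd h (not_le.2 (mul_pos (sub_pos.2 hlt) (sub_pos.2 h2)))

/-- If both the norms of the mappings and the lengths of the steps were ordered the wrong way, the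
product in `proxPoint_compare` would be positive. Together with `norm_sub_proxPoint_le` this
transfers the test at the old parameter to the parameter of the accepted step. -/
theorem norm_G_mono (hlam : 0 ≤ P.lam) {t t' : ℝ} (ht : 0 < t) (htt : t ≤ t') (x : E n) :
    ‖P.G t x‖ ≤ ‖P.G t' x‖ := by
  have ht' := ht.trans_le htt
  rw [norm_G ht, norm_G ht']
  by_contra! hlt
  have h := proxPoint_compare hlam ht ht' x
  have h2 : ‖x - P.proxPoint t' x‖ < ‖x - P.proxPoint t x‖ := by
    refine lt_of_mul_lt_mul_left ?_ ht.le
    exact (mul_le_mul_of_nonneg_right htt (norm_nonneg _)).trans_lt hlt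
  exact absurd h (not_le.2 (mul_pos (sub_pos.2 h2) (sub_pos.2 hlt)))

/-- Sufficient decrease of a proximal gradient step from a point of the level set. -/
theorem φ_proxPoint_le {Lg LH : ℝ} (hlam : 0 ≤ P.lam) (hS : P.Smooth Lg LH) {x : E n}
    (hx : x ∈ P.levelSet) {t : ℝ} (ht : Lg / 2 ≤ t) :
    P.φ (P.proxPoint t x) ≤ P.φ x - (t - Lg / 2) * ‖x - P.proxPoint t x‖ ^ 2 := by
  obtain ⟨U, hU, hLU, hf, hLg, -⟩ := hS.nhd
  have ht0 : 0 < t := (half_pos hS.Lg_pos).trans_le ht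
  have hdf : ∀ y ∈ U, DifferentiableAt ℝ P.f y := fun y hy =>
    (hf.differentiableOn (by norm_num)).differentiableAt (hU.mem_nhds hy)
  set p := P.proxPoint t x
  have hvar := proxPoint_variational hlam ht0 x x
  change P.lam * l1norm p + ⟪t • (x - p) - ∇ P.f x, x - p⟫ ≤ _ at hvar
  rw [inner_sub_left, inner_smul_left, real_inner_self_eq_norm_sq, ← neg_sub p x,
    inner_neg_right, norm_neg] at hvar
  simp only [conj_trivial] at hvar
  -- Convexity scales the variational inequality at y = x by `a`, and a² ≤ a makes the quadratic
  -- term of the descent lemma linear in `a`.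
  have key : ∀ a ∈ Icc (0 : ℝ) 1, (∀ s ∈ Icc 0 a, x + s • (p - x) ∈ U) →
      P.φ (x + a • (p - x)) ≤ P.φ x - a * (t - Lg / 2) * ‖x - p‖ ^ 2 := by
    intro a ha hseg
    have h1 := le_of_lipschitz_gradient ha.1 hdf hLg hseg
    have h2 := mul_le_mul_of_nonneg_left (l1norm_segment_le x p ha.1 ha.2) hlam
    have h3 := mul_le_mul_of_nonneg_left hvar ha.1
    have h4 : Lg / 2 * a ^ 2 * ‖p - x‖ ^ 2 ≤ a * (Lg / 2) * ‖p - x‖ ^ 2 := by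
      refine mul_le_mul_of_nonneg_right ?_ (sq_nonneg _)
      have : a ^ 2 ≤ a := by nlinarith [ha.1, ha.2]
      nlinarith [hS.Lg_pos]
    rw [norm_sub_rev x p]
    simp only [φ]
    linarith
  have hmem := path_mem_of_nhd hS.isClosed_levelSet hU hLU (γ := fun s : ℝ => x + s • (p - x))
    (b := 1) (by fun_prop) (by simpa using hx) fun a ha hseg => by
      refine (key a ha hseg).trans ((sub_le_self _ ?_).trans hx)
      exact mul_nonneg (mul_nonneg ha.1 (sub_nonneg.2 ht)) (sq_nonneg _)
  have := key 1 ⟨zero_le_one, le_rfl⟩ fun s hs => hLU (hmem s hs)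
  simpa using this

/-- The proximal line search ends, with a bounded parameter and sufficient decrease. -/
theorem exists_proxStep {Lg LH : ℝ} (hA : P.Admissible) (hS : P.Smooth Lg LH) {x : E n}
    (hx : x ∈ P.levelSet) {t : ℝ} (ht : 0 < t) (htT : t ≤ P.tmax Lg) (hG : P.εg < ‖P.G t x‖) :
    ∃ j, firstIndex (P.ProxTest x) = some j ∧ P.β ^ j ≤ P.tmax Lg ∧
      P.φ (P.proxPoint (P.β ^ j) x) ≤ P.φ x - P.cpg Lg / P.tmax Lg * P.εg ^ 2 := by
  have hβ : ∀ j : ℕ, 0 < P.β ^ j := fun j => pow_pos (zero_lt_one.trans hA.one_lt_β) j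
  have hβ1 : ∀ j : ℕ, 1 ≤ P.β ^ j := fun j => one_le_pow₀ hA.one_lt_β.le
  have hden : 0 < 2 - 2 * P.ηbar := by linarith [hA.ηbar_lt]
  have hT := P.one_le_tmax Lg
  have hT0 : 0 < P.tmax Lg := zero_lt_one.trans_le hT
  -- The acceptance test is strict, so a nonzero step is needed at every parameter; it is inherited
  -- from the one at `t` by the two monotonicities.
  have hpos : ∀ t' : ℝ, 0 < t' → 0 < ‖x - P.proxPoint t' x‖ := by
    intro t' ht'
    have h0 : 0 < ‖P.G t x‖ := hA.εg_pos.trans hG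
    rcases le_total t t' with h | h
    · have := h0.trans_le (norm_G_mono hA.lam_pos.le ht h x)
      rw [norm_G ht'] at this
      exact pos_of_mul_pos_right this ht'.le
    · rw [norm_G ht] at h0
      exact (pos_of_mul_pos_right h0 ht.le).trans_le
        (norm_sub_proxPoint_le hA.lam_pos.le ht h ht' x)
  -- The condition β^j > Lg/(2 − 2η̄) is exactly η̄β^j < β^j − Lg/2.
  have htest : ∀ j : ℕ, Lg / (2 - 2 * P.ηbar) < P.β ^ j → P.ProxTest x j := by
    intro j hj
    rw [div_lt_iff₀ hden] at hj
    have hle : Lg / 2 ≤ P.β ^ j := by nlinarith [hβ j, hA.ηbar_pos]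
    refine (φ_proxPoint_le hA.lam_pos.le hS hx hle).trans_lt ?_
    rw [norm_G (hβ j), mul_pow]
    have h1 : P.ηbar / P.β ^ j * ((P.β ^ j) ^ 2 * ‖x - P.proxPoint (P.β ^ j) x‖ ^ 2) =
        P.ηbar * P.β ^ j * ‖x - P.proxPoint (P.β ^ j) x‖ ^ 2 := by
      have := (hβ j).ne'
      field_simp
    rw [h1]
    have h2 := pow_pos (hpos _ (hβ j)) 2
    have h3 : P.ηbar * P.β ^ j < P.β ^ j - Lg / 2 := by linarith
    linarith [mul_lt_mul_of_pos_right h3 h2]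
  obtain ⟨j, hj, hQ, hmin⟩ := exists_firstIndex (Q := P.ProxTest x)
    ((pow_unbounded_of_one_lt _ hA.one_lt_β).imp htest)
  have hjT : P.β ^ j ≤ P.tmax Lg := by
    cases j with
    | zero => simpa using hT
    | succ i =>
      refine le_max_of_le_left ?_
      -- The index before the accepted one was rejected, so β^i ≤ Lg/(2 − 2η̄); one more factor β
      -- gives `tmax`.
      have := not_lt.1 fun h => hmin i i.lt_succ_self (htest i h)
      rw [pow_succ, mul_comm, mul_div_assoc]
      exact mul_le_mul_of_nonneg_left this (zero_lt_one.trans hA.one_lt_β).le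
  refine ⟨j, hj, hjT, hQ.le.trans (sub_le_sub_left ?_ _)⟩
  -- If t ≤ β^j, the mapping at β^j is at least as large as at `t`. If β^j ≤ t, the step at β^j is
  -- at least as long as the one at `t`, hence longer than εg/t ≥ εg/T; this case costs the extra
  -- factor T.
  have hbound : P.εg ^ 2 / P.tmax Lg ^ 2 ≤ 1 / P.β ^ j * ‖P.G (P.β ^ j) x‖ ^ 2 := by
    rw [div_mul_eq_mul_div, one_mul, div_le_div_iff₀ (pow_pos hT0 2) (hβ j)]
    rcases le_total t (P.β ^ j) with h | h
    · have h1 := pow_le_pow_left₀ hA.εg_pos.le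
        (hG.le.trans (norm_G_mono hA.lam_pos.le ht h x)) 2
      have h2 : P.β ^ j ≤ P.tmax Lg ^ 2 := hjT.trans (by nlinarith)
      exact mul_le_mul h1 h2 (hβ j).le (sq_nonneg _)
    · have h1 := norm_sub_proxPoint_le hA.lam_pos.le ht h (hβ j) x
      rw [norm_G ht] at hG
      rw [norm_G (hβ j)]
      set b := ‖x - P.proxPoint (P.β ^ j) x‖
      have h2 : P.εg ≤ b * P.tmax Lg := by
        refine hG.le.trans ?_
        rw [mul_comm b]
        exact mul_le_mul htT h1 (norm_nonneg _) hT0.le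
      have h3 := pow_le_pow_left₀ hA.εg_pos.le h2 2
      have h4 : (b * P.tmax Lg) ^ 2 * P.β ^ j ≤ (P.β ^ j * b) ^ 2 * P.tmax Lg ^ 2 := by
        have : P.β ^ j ≤ (P.β ^ j) ^ 2 := by nlinarith [hβ1 j]
        nlinarith [mul_le_mul_of_nonneg_left this (sq_nonneg (b * P.tmax Lg))]
      exact (mul_le_mul_of_nonneg_right h3 (hβ j).le).trans h4
  calc P.cpg Lg / P.tmax Lg * P.εg ^ 2 = P.ηbar * (P.εg ^ 2 / P.tmax Lg ^ 2) := by
        rw [cpg, ← tmax]; field_simp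
    _ ≤ P.ηbar * (1 / P.β ^ j * ‖P.G (P.β ^ j) x‖ ^ 2) :=
        mul_le_mul_of_nonneg_left hbound hA.ηbar_pos.le
    _ = _ := by ring

/-! ### Negative curvature steps -/

theorem s_eq_zero {x : E n} {i : Fin n} (h : x i = 0) : P.s x i = 0 := by
  simp [s, h]

theorem abs_s_le_one (hA : P.Admissible) (x : E n) (i : Fin n) : |P.s x i| ≤ 1 := by
  unfold s
  split_ifs with h
  · simp
  · exact (not_lt.1 h).trans (Real.sqrt_le_one.2 hA.εg_lt.le)

/-- The scaled direction `S d`. -/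
noncomputable def scaledDir (P : Setup n) (x u : E n) : E n :=
  WithLp.toLp 2 fun i => P.s x i * P.dir x u i

theorem sgn_sq (r : ℝ) : sgn r ^ 2 = 1 := by
  unfold sgn; split_ifs <;> norm_num

theorem sgn_mul_self_nonneg (r : ℝ) : 0 ≤ sgn r * r := by
  unfold sgn
  split_ifs with h
  · simpa using h
  · linarith

theorem norm_dir {x u : E n} (hu : ∑ i : Supp x, u i ^ 2 = 1) : ‖P.dir x u‖ = |P.curv x u| := by
  have h1 : ‖P.dir x u‖ ^ 2 = |P.curv x u| ^ 2 := by
    rw [EuclideanSpace.norm_sq_eq, ← sum_supp x]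
    · calc _ = ∑ i : Supp x, |P.curv x u| ^ 2 * u i ^ 2 := by
            refine Finset.sum_congr rfl fun i _ => ?_
            simp only [dir, if_pos i.2, Real.norm_eq_abs, sq_abs, mul_pow, neg_sq, sgn_sq, one_mul]
        _ = _ := by rw [← Finset.mul_sum, hu, mul_one]
    · intro i hi
      simp [dir, hi]
  exact (pow_left_inj₀ (norm_nonneg _) (abs_nonneg _) two_ne_zero).1 h1

theorem norm_scaledDir_le (hA : P.Admissible) (x u : E n) : ‖P.scaledDir x u‖ ≤ ‖P.dir x u‖ := by
  rw [EuclideanSpace.norm_eq, EuclideanSpace.norm_eq]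
  refine Real.sqrt_le_sqrt (Finset.sum_le_sum fun i _ => ?_)
  refine pow_le_pow_left₀ (norm_nonneg _) ?_ 2
  change ‖P.s x i * P.dir x u i‖ ≤ _
  rw [norm_mul]
  exact mul_le_of_le_one_left (norm_nonneg _) (abs_s_le_one hA x i)

/-- The factor `sgn` in the direction is chosen for this: the sum equals −|uᵀHu|·|gᵀSu|. -/
theorem sum_g_mul_scaledDir (x u : E n) :
    ∑ i, P.g x i * P.scaledDir x u i ≤ 0 := by
  rw [← sum_supp x (fun i => P.g x i * P.scaledDir x u i)
    (fun i hi => by simp [scaledDir, s_eq_zero hi])]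
  set q := ∑ i : Supp x, P.g x i * P.s x i * u i with hq
  have : ∑ i : Supp x, P.g x i * P.scaledDir x u i = -(|P.curv x u| * (sgn q * q)) := by
    rw [← mul_assoc, ← neg_mul]
    conv_rhs => enter [2]; rw [hq]
    rw [Finset.mul_sum]
    refine Finset.sum_congr rfl fun i _ => ?_
    simp only [scaledDir, dir, if_pos i.2, ← hq]
    ring
  rw [this, neg_nonpos]
  exact mul_nonneg (abs_nonneg _) (sgn_mul_self_nonneg q)

theorem fderiv_gradient_apply (f : E n → ℝ) (x v : E n) (i : Fin n) :
    (fderiv ℝ (∇ f) x v) i = ∑ j, hessian f x i j * v j := by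
  conv_lhs => rw [← (EuclideanSpace.basisFun (Fin n) ℝ).sum_repr v]
  simp [hessian, mul_comm]

/-- On the support Sd = κSu with κ² = (uᵀHu)², and the quadratic form of the Hessian at Su is uᵀHu.
-/
theorem inner_hessian_scaledDir (x u : E n) :
    ⟪fderiv ℝ (∇ P.f) x (P.scaledDir x u), P.scaledDir x u⟫ = P.curv x u ^ 3 := by
  set v := P.scaledDir x u with hv
  set κ : ℝ := -(sgn (∑ i : Supp x, P.g x i * P.s x i * u i)) * |P.curv x u| with hκ
  have hκ2 : κ ^ 2 = P.curv x u ^ 2 := by rw [hκ, mul_pow, neg_sq, sgn_sq, sq_abs, one_mul]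
  have hv0 : ∀ i, x i = 0 → v i = 0 := fun i hi => by simp [hv, scaledDir, s_eq_zero hi]
  have hvi : ∀ i : Supp x, v i = κ * (P.s x i * u i) := fun i => by
    simp only [hv, scaledDir, dir, if_pos i.2, ← hκ]; ring
  have hin : ⟪fderiv ℝ (∇ P.f) x v, v⟫ = ∑ i, v i * ∑ j, hessian P.f x i j * v j := by
    rw [PiLp.inner_apply]
    refine Finset.sum_congr rfl fun i _ => ?_
    rw [fderiv_gradient_apply]
    simp
  have hcurv : P.curv x u = ∑ i : Supp x, (P.s x i * u i) *
      ∑ j : Supp x, hessian P.f x i j * (P.s x j * u j) := by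
    simp only [curv, scaledHessian, dotProduct, Matrix.mulVec, Matrix.mul_diagonal,
      Matrix.diagonal_mul, Matrix.submatrix_apply, Finset.mul_sum]
    refine Finset.sum_congr rfl fun i _ => Finset.sum_congr rfl fun j _ => ?_
    ring
  calc ⟪fderiv ℝ (∇ P.f) x v, v⟫
      = ∑ i : Supp x, v i * ∑ j : Supp x, hessian P.f x i j * v j := by
        rw [hin, ← sum_supp x _ (fun i hi => by rw [hv0 i hi, zero_mul])]
        refine Finset.sum_congr rfl fun i _ => ?_
        rw [← sum_supp x _ (fun j hj => by rw [hv0 j hj, mul_zero])]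
    _ = κ ^ 2 * P.curv x u := by
        rw [hcurv, Finset.mul_sum]
        refine Finset.sum_congr rfl fun i _ => ?_
        rw [Finset.mul_sum, Finset.mul_sum, Finset.mul_sum]
        refine Finset.sum_congr rfl fun j _ => ?_
        rw [hvi, hvi]; ring
    _ = _ := by rw [hκ2]; ring

/-- As long as no sign changes, the `ℓ₁` norm is linear along the scaled direction. -/
theorem inner_gradient_add_l1norm (hA : P.Admissible) {x u : E n} {τ : ℝ} (hτ : 0 ≤ τ)
    (h : τ * ‖P.dir x u‖ ≤ √P.εg) :
    τ * ⟪∇ P.f x, P.scaledDir x u⟫ + P.lam * l1norm (x + τ • P.scaledDir x u) =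
      P.lam * l1norm x + τ * ∑ i, P.g x i * P.scaledDir x u i := by
  have hsqrt : √P.εg < 1 := by
    rw [Real.sqrt_lt' one_pos]; simpa using hA.εg_lt
  rw [PiLp.inner_apply]
  unfold l1norm
  rw [Finset.mul_sum, Finset.mul_sum, Finset.mul_sum, Finset.mul_sum, ← Finset.sum_add_distrib,
    ← Finset.sum_add_distrib]
  refine Finset.sum_congr rfl fun i _ => ?_
  simp only [PiLp.add_apply, PiLp.smul_apply, smul_eq_mul, RCLike.inner_apply, conj_trivial]
  have hd : |τ * P.dir x u i| ≤ √P.εg := by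
    rw [abs_mul, abs_of_nonneg hτ]
    refine le_trans ?_ h
    exact mul_le_mul_of_nonneg_left (PiLp.norm_apply_le (P.dir x u) i) hτ
  -- No sign change: a large coordinate (s_i = 1) exceeds √εg and moves by at most √εg; a small one
  -- has s_i = x_i and moves by at most √εg·|x_i| ≤ |x_i|.
  have hw : |τ * P.scaledDir x u i| ≤ |x i| := by
    change |τ * (P.s x i * P.dir x u i)| ≤ _
    unfold s
    split_ifs with hs
    · rw [one_mul]; exact hd.trans hs.le
    · rw [mul_left_comm, abs_mul]
      exact mul_le_of_le_one_right (abs_nonneg _) (hd.trans hsqrt.le)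
  rcases lt_trichotomy (x i) 0 with hx | hx | hx
  · rw [abs_add_of_nonpos_left hx.le hw]
    simp only [g, if_neg hx.not_gt, if_pos hx]
    ring
  · have : P.scaledDir x u i = 0 := by simp [scaledDir, s_eq_zero hx]
    simp [this]
  · rw [abs_add_of_nonneg_left hx.le hw]
    simp only [g, if_pos hx]
    ring

/-- Decrease along the negative curvature direction. -/
theorem φ_ncPoint_le {Lg LH : ℝ} (hA : P.Admissible) (hS : P.Smooth Lg LH) {x u : E n}
    (hx : x ∈ P.levelSet) (hu : ∑ i : Supp x, u i ^ 2 = 1) (hc : P.curv x u ≤ 0)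
    {τ : ℝ} (hτ : 0 ≤ τ) (h : τ * |P.curv x u| ≤ √P.εg) (hLH : τ * LH ≤ 3) :
    P.φ (P.ncPoint x u τ) ≤
      P.φ x - (τ ^ 2 / 2 - LH / 6 * τ ^ 3) * |P.curv x u| ^ 3 := by
  obtain ⟨U, hU, hLU, hf, -, hH⟩ := hS.nhd
  have hdf : ∀ y ∈ U, DifferentiableAt ℝ P.f y := fun y hy =>
    (hf.differentiableOn (by norm_num)).differentiableAt (hU.mem_nhds hy)
  have hdg : ∀ y ∈ U, DifferentiableAt ℝ (∇ P.f) y := fun y hy => by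
    have h1 : ContDiffOn ℝ 1 (fderiv ℝ P.f) U := hf.fderiv_of_isOpen hU (by norm_num)
    have h2 := (h1.differentiableOn (by norm_num)).differentiableAt (hU.mem_nhds hy)
    exact (InnerProductSpace.toDual ℝ (E n)).symm.toContinuousLinearEquiv.differentiableAt.comp y h2
  set v := P.scaledDir x u with hv
  have key : ∀ a ∈ Icc 0 τ, (∀ s ∈ Icc 0 a, x + s • v ∈ U) →
      P.φ (x + a • v) ≤ P.φ x - (a ^ 2 / 2 - LH / 6 * a ^ 3) * |P.curv x u| ^ 3 := by
    intro a ha hseg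
    have h1 := le_of_lipschitz_hessian ha.1 hdf hdg hH hseg
    rw [inner_hessian_scaledDir] at h1
    have h2 := inner_gradient_add_l1norm hA (x := x) (u := u) ha.1
      ((mul_le_mul_of_nonneg_right ha.2 (norm_nonneg _)).trans (by rwa [norm_dir hu]))
    have h3 := mul_le_mul_of_nonneg_left (sum_g_mul_scaledDir (P := P) x u) ha.1
    have h4 : ‖v‖ ^ 3 ≤ |P.curv x u| ^ 3 := by
      refine pow_le_pow_left₀ (norm_nonneg _) ?_ 3
      rw [← norm_dir hu]; exact norm_scaledDir_le hA x u
    have h5 := mul_le_mul_of_nonneg_left h4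
      (mul_nonneg (div_nonneg hS.LH_pos.le (by norm_num : (0 : ℝ) ≤ 6)) (pow_nonneg ha.1 3))
    have h6 : P.curv x u ^ 3 = -|P.curv x u| ^ 3 := by rw [abs_of_nonpos hc]; ring
    rw [h6] at h1
    simp only [φ]
    rw [← hv] at h2 h3
    linarith
  have hmem := path_mem_of_nhd hS.isClosed_levelSet hU hLU (γ := fun s : ℝ => x + s • v)
    (b := τ) (by fun_prop) (by simpa using hx) fun a ha hseg => by
      refine (key a ha hseg).trans ((sub_le_self _ ?_).trans hx)
      refine mul_nonneg ?_ (by positivity)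
      -- Makes a²/2 − LH·a³/6 nonnegative at every intermediate `a`, so the segment stays in the
      -- level set.
      have : a * LH ≤ 3 := (mul_le_mul_of_nonneg_right ha.2 hS.LH_pos.le).trans hLH
      nlinarith [sq_nonneg a]
  exact key τ ⟨hτ, le_rfl⟩ fun s hs => hLU (hmem s hs)

/-- The line search along a negative curvature direction ends with sufficient decrease. -/
theorem exists_ncStep {Lg LH : ℝ} (hA : P.Admissible) (hS : P.Smooth Lg LH) {x u : E n}
    (hx : x ∈ P.levelSet) (hu : ∑ i : Supp x, u i ^ 2 = 1) (hc : P.curv x u ≤ -(P.εh / 2)) :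
    ∃ j, firstIndex (P.NCTest x u) = some j ∧
      P.φ (P.ncPoint x u (P.θ ^ j)) ≤
        P.φ x - P.cnc LH / 8 * min (P.εg * P.εh) (P.εh ^ 3) := by
  have hc0 : P.curv x u ≤ 0 := hc.trans (by linarith [hA.εh_pos])
  set D := |P.curv x u| with hD
  have hDh : P.εh / 2 ≤ D := by rw [hD, abs_of_nonpos hc0]; linarith
  have hD0 : 0 < D := (half_pos hA.εh_pos).trans_le hDh
  have hLH := hS.LH_pos
  have hη : 0 < 1 - 2 * P.η := by linarith [hA.η_lt]
  -- The first condition prevents sign changes; the second is τ²/2 − LH·τ³/6 > ητ² for τ = θ^j.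
  have htest : ∀ j : ℕ, P.θ ^ j * D ≤ √P.εg → P.θ ^ j * LH < 3 * (1 - 2 * P.η) →
      P.NCTest x u j := by
    intro j h1 h2
    have hτ := pow_pos hA.θ_pos j
    refine (φ_ncPoint_le hA hS hx hu hc0 hτ.le h1 (by linarith [hA.η_pos])).trans_lt ?_
    rw [norm_dir hu, ← hD, mul_comm 2 j, pow_mul]
    have h3 : P.η * (P.θ ^ j) ^ 2 < (P.θ ^ j) ^ 2 / 2 - LH / 6 * (P.θ ^ j) ^ 3 := by
      nlinarith [mul_lt_mul_of_pos_left h2 (pow_pos hτ 2)]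
    linarith [mul_lt_mul_of_pos_right h3 (pow_pos hD0 3)]
  have hex : ∃ j, P.NCTest x u j := by
    obtain ⟨j, hj⟩ := exists_pow_lt_of_lt_one (y := P.θ)
      (lt_min (div_pos (Real.sqrt_pos.2 hA.εg_pos) hD0)
        (div_pos (mul_pos three_pos hη) hLH)) hA.θ_lt
    exact ⟨j, htest j ((lt_div_iff₀ hD0).1 (hj.trans_le (min_le_left _ _))).le
      ((lt_div_iff₀ hLH).1 (hj.trans_le (min_le_right _ _)))⟩
  obtain ⟨j, hj, hQ, hmin⟩ := exists_firstIndex hex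
  refine ⟨j, hj, hQ.le.trans (sub_le_sub_left ?_ _)⟩
  rw [norm_dir hu, ← hD]
  set m := min 1 (9 * (1 - 2 * P.η) ^ 2 / LH ^ 2) with hm
  have hm0 : 0 ≤ m := le_min zero_le_one (by positivity)
  have hm1 : m ≤ 1 := min_le_left _ _
  have hηθ : 0 < P.η * P.θ ^ 2 := mul_pos hA.η_pos (pow_pos hA.θ_pos 2)
  have hD3 : P.εh ^ 3 / 8 ≤ D ^ 3 := by
    have := pow_le_pow_left₀ (half_pos hA.εh_pos).le hDh 3
    calc _ = (P.εh / 2) ^ 3 := by ring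
      _ ≤ _ := this
  have hh3 : 0 < P.εh ^ 3 := pow_pos hA.εh_pos 3
  have hθ1 : P.θ ^ 2 ≤ 1 := pow_le_one₀ hA.θ_pos.le hA.θ_lt.le
  have hmin0 : 0 ≤ min (P.εg * P.εh) (P.εh ^ 3) :=
    le_min (mul_pos hA.εg_pos hA.εh_pos).le hh3.le
  cases j with
  | zero =>
    calc P.cnc LH / 8 * min (P.εg * P.εh) (P.εh ^ 3)
        = P.η * (P.θ ^ 2 * m * (min (P.εg * P.εh) (P.εh ^ 3) / 8)) := by rw [cnc, ← hm]; ring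
      _ ≤ P.η * (1 * 1 * (P.εh ^ 3 / 8)) := by
        gcongr
        · exact hA.η_pos.le
        · exact min_le_right _ _
      _ ≤ P.η * D ^ 3 := by
        rw [one_mul, one_mul]; exact mul_le_mul_of_nonneg_left hD3 hA.η_pos.le
      _ = _ := by simp
  | succ i =>
    have hτ := pow_pos hA.θ_pos i
    -- The preceding trial was rejected, so one of the two conditions of `htest` failed for it. The
    -- first failure gives τ²D³ ≥ εg·εh/2, the second τ² ≥ 9(1 − 2η)²/LH² with D³ ≥ εh³/8; passing
    -- from θ^i to θ^(i+1) costs the θ² in `cnc`.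
    have hi : √P.εg < P.θ ^ i * D ∨ 3 * (1 - 2 * P.η) ≤ P.θ ^ i * LH := by
      by_contra! hcon
      exact hmin i i.lt_succ_self (htest i hcon.1 hcon.2)
    have hkey : m / 8 * min (P.εg * P.εh) (P.εh ^ 3) ≤ (P.θ ^ i) ^ 2 * D ^ 3 := by
      rcases hi with hi | hi
      · have h1 := pow_le_pow_left₀ (Real.sqrt_nonneg _) hi.le 2
        rw [Real.sq_sqrt hA.εg_pos.le] at h1
        calc m / 8 * min (P.εg * P.εh) (P.εh ^ 3) ≤ 1 / 8 * (P.εg * P.εh) := by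
              gcongr; exact min_le_left _ _
          _ ≤ P.εg * (P.εh / 2) := by nlinarith [mul_pos hA.εg_pos hA.εh_pos]
          _ ≤ (P.θ ^ i * D) ^ 2 * D :=
              mul_le_mul h1 hDh (half_pos hA.εh_pos).le (sq_nonneg _)
          _ = _ := by ring
      · have h1 := pow_le_pow_left₀ (by positivity) hi 2
        have h2 : m ≤ (P.θ ^ i) ^ 2 := by
          refine (min_le_right _ _).trans ?_
          rw [div_le_iff₀ (pow_pos hLH 2)]
          calc _ = (3 * (1 - 2 * P.η)) ^ 2 := by ring
            _ ≤ _ := h1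
            _ = _ := by ring
        calc m / 8 * min (P.εg * P.εh) (P.εh ^ 3) ≤ m / 8 * P.εh ^ 3 := by
              gcongr; exact min_le_right _ _
          _ = m * (P.εh ^ 3 / 8) := by ring
          _ ≤ _ := mul_le_mul h2 hD3 (by positivity) (by positivity)
    calc P.cnc LH / 8 * min (P.εg * P.εh) (P.εh ^ 3)
        = P.η * P.θ ^ 2 * (m / 8 * min (P.εg * P.εh) (P.εh ^ 3)) := by rw [cnc, ← hm]; ring
      _ ≤ P.η * P.θ ^ 2 * ((P.θ ^ i) ^ 2 * D ^ 3) := mul_le_mul_of_nonneg_left hkey hηθ.le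
      _ = _ := by ring

end Setup

/-! ### Probability that all trials succeed -/

open Classical in
/-- If each of at most `b` trials succeeds with conditional probability at least `q`, then all of
them succeed with probability at least `q ^ b`. -/
theorem pow_mul_measureReal_le {Ω : Type*} {mΩ : MeasurableSpace Ω} (μ : Measure Ω)
    [IsFiniteMeasure μ] (ℱ : Filtration ℕ mΩ) {Cal Good : ℕ → Set Ω}
    (hCal : ∀ k, MeasurableSet[ℱ k] (Cal k)) (hGood : ∀ k, MeasurableSet[ℱ (k + 1)] (Good k))
    {q : ℝ} (hq : 0 ≤ q) (hq1 : q ≤ 1)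
    (hprob : ∀ k A, MeasurableSet[ℱ k] A → A ⊆ Cal k → q * μ.real A ≤ μ.real (A ∩ Good k))
    (d : ℕ) : ∀ (m b : ℕ) (A : Set Ω), MeasurableSet[ℱ m] A →
      (∀ ω ∈ A, Nat.count (fun k => ω ∈ Cal (m + k)) d ≤ b) →
      q ^ b * μ.real A ≤
        μ.real (A ∩ {ω | ∀ k < d, ω ∈ Cal (m + k) → ω ∈ Good (m + k)}) := by
  induction d with
  | zero =>
    intro m b A _ _
    simpa using mul_le_of_le_one_left measureReal_nonneg (pow_le_one₀ hq hq1)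
  | succ d ih =>
    intro m b A hA hb
    have hshift : ∀ k, m + 1 + k = m + k + 1 := Nat.add_right_comm m 1
    have hcount : ∀ ω, Nat.count (fun k => ω ∈ Cal (m + k)) (d + 1) =
        Nat.count (fun k => ω ∈ Cal (m + 1 + k)) d + if ω ∈ Cal m then 1 else 0 := by
      intro ω
      simp only [Nat.count_succ', hshift, add_zero, ← Nat.add_assoc]
    have hgood : ∀ ω, (∀ k < d + 1, ω ∈ Cal (m + k) → ω ∈ Good (m + k)) ↔
        (ω ∈ Cal m → ω ∈ Good m) ∧
          ∀ k < d, ω ∈ Cal (m + 1 + k) → ω ∈ Good (m + 1 + k) := by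
      intro ω
      rw [Nat.forall_lt_succ_left]
      simp only [hshift, add_zero, ← Nat.add_assoc]
    have hle : ∀ s, MeasurableSet[ℱ m] s → MeasurableSet[ℱ (m + 1)] s :=
      ℱ.mono (Nat.le_succ m)
    -- Induction on the horizon, splitting `A` by whether a trial takes place at time `m`: without a
    -- trial the budget `b` is kept, after a successful trial it drops by one.
    have h1 := ih (m + 1) b (A \ Cal m) ((hle _ hA).diff (hle _ (hCal m))) fun ω hω => by
      have := hb ω hω.1
      rwa [hcount, if_neg hω.2] at this
    have h2 := ih (m + 1) (b - 1) (A ∩ Cal m ∩ Good m)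
      (((hle _ hA).inter (hle _ (hCal m))).inter (hGood m)) fun ω hω => by
        have := hb ω hω.1.1
        rw [hcount, if_pos hω.1.2] at this
        omega
    have h3 : q ^ b * μ.real (A ∩ Cal m) ≤ q ^ (b - 1) * μ.real (A ∩ Cal m ∩ Good m) := by
      cases b with
      -- With no budget left, no trial can take place at time `m`.
      | zero =>
        have : A ∩ Cal m = ∅ := by
          refine eq_empty_of_forall_notMem fun ω hω => ?_
          have := hb ω hω.1
          rw [hcount, if_pos hω.2] at this
          omega
        simp [this]
      | succ b =>
        rw [Nat.add_sub_cancel, pow_succ, mul_assoc]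
        exact mul_le_mul_of_nonneg_left (hprob m _ (hA.inter (hCal m)) inter_subset_right)
          (pow_nonneg hq _)
    have hCm : MeasurableSet (Cal m) := ℱ.le m _ (hCal m)
    rw [← measureReal_inter_add_sdiff (μ := μ) (s := A) hCm, mul_add,
      ← measureReal_inter_add_sdiff (μ := μ)
        (s := A ∩ {ω | ∀ k < d + 1, ω ∈ Cal (m + k) → ω ∈ Good (m + k)}) hCm]
    refine add_le_add (h3.trans (h2.trans (measureReal_mono ?_))) (h1.trans (measureReal_mono ?_))
    · rintro ω ⟨⟨⟨h4, h5⟩, h6⟩, h7⟩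
      exact ⟨⟨h4, (hgood ω).2 ⟨fun _ => h6, h7⟩⟩, h5⟩
    · rintro ω ⟨⟨h4, h5⟩, h7⟩
      exact ⟨⟨h4, (hgood ω).2 ⟨fun h => absurd h h5, h7⟩⟩, h5⟩

/-! ### Counting steps and bounding operations -/

namespace Setup

variable {n : ℕ} {P : Setup n}

open Classical in
/-- The number of oracle calls in the first `m` iterations. -/
noncomputable def callCount (P : Setup n) (r : ℕ → Response n) (m : ℕ) : ℕ :=
  Nat.count (fun k => P.Calls (P.traj r k)) m

/-- The state is one in which a proximal gradient step is taken. -/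
def ProxPhase (P : Setup n) : State n → Prop
  | .running x t => P.εg < ‖P.G t x‖
  | .stopped _ => False
  | .diverged => False

open Classical in
/-- The number of proximal gradient steps in the first `m` iterations. -/
noncomputable def proxCount (P : Setup n) (r : ℕ → Response n) (m : ℕ) : ℕ :=
  Nat.count (fun k => P.ProxPhase (P.traj r k)) m

/-- The decrease guaranteed by a negative curvature step. -/
noncomputable def ncDecrease (P : Setup n) (LH : ℝ) : ℝ :=
  P.cnc LH / 8 * min (P.εg * P.εh) (P.εh ^ 3)

/-- The decrease guaranteed by a proximal gradient step. -/
noncomputable def proxDecrease (P : Setup n) (Lg : ℝ) : ℝ := P.cpg Lg / P.tmax Lg * P.εg ^ 2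

/-- The invariant of the algorithm in a state reached with `a` oracle calls and `b` proximal
gradient steps. -/
def Invariant (P : Setup n) (Lg LH φlow : ℝ) (a b : ℕ) : State n → Prop
  | .running x t => x ∈ P.levelSet ∧ 0 < t ∧ t ≤ P.tmax Lg ∧
      P.ncDecrease LH * a + P.proxDecrease Lg * b ≤ P.φ P.x0 - P.φ x
  | .stopped x => P.StrongFirstOrder x ∧
      P.ncDecrease LH * (a - 1) + P.proxDecrease Lg * b ≤ P.φ P.x0 - φlow
  | .diverged => False

theorem step_of_lt {x : E n} {t : ℝ} {r : Response n} {j : ℕ} (h : P.εg < ‖P.G t x‖)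
    (hj : firstIndex (P.ProxTest x) = some j) :
    P.step (.running x t) r = .running (P.proxPoint (P.β ^ j) x) (P.β ^ j) ∧
      P.cost (.running x t) r = 1 + (j + 1) := by
  simp only [step, cost, if_pos h, hj, and_self]

theorem step_of_le_of_none {x : E n} {t : ℝ} {r : Response n} (h : ‖P.G t x‖ ≤ P.εg)
    (hr : r.vec = none) : P.step (.running x t) r = .stopped x := by
  simp only [step, if_neg h.not_gt, hr]

theorem step_of_le_of_some {x u : E n} {t : ℝ} {r : Response n} {j : ℕ} (h : ‖P.G t x‖ ≤ P.εg)
    (hr : r.vec = some u) (hj : firstIndex (P.NCTest x u) = some j) :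
    P.step (.running x t) r = .running (P.ncPoint x u (P.θ ^ j)) (P.θ ^ j) := by
  simp only [step, if_neg h.not_gt, hr, hj]

theorem cost_of_le {x : E n} {t : ℝ} {r : Response n} (h : ‖P.G t x‖ ≤ P.εg) :
    P.cost (.running x t) r = 1 + r.hvp := by
  simp only [cost, if_neg h.not_gt]

theorem cnc_pos {LH : ℝ} (hA : P.Admissible) (hLH : 0 < LH) : 0 < P.cnc LH := by
  have : 0 < 1 - 2 * P.η := by linarith [hA.η_lt]
  have := hA.η_pos
  have := hA.θ_pos
  unfold cnc
  positivity

theorem cpg_pos {Lg : ℝ} (hA : P.Admissible) : 0 < P.cpg Lg :=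
  div_pos hA.ηbar_pos (zero_lt_one.trans_le (le_max_right _ _))

theorem ncDecrease_pos {LH : ℝ} (hA : P.Admissible) (hLH : 0 < LH) : 0 < P.ncDecrease LH :=
  mul_pos (div_pos (cnc_pos hA hLH) (by norm_num))
    (lt_min (mul_pos hA.εg_pos hA.εh_pos) (pow_pos hA.εh_pos 3))

theorem proxDecrease_pos {Lg : ℝ} (hA : P.Admissible) : 0 < P.proxDecrease Lg :=
  mul_pos (div_pos (cpg_pos hA) (zero_lt_one.trans_le (one_le_tmax Lg))) (pow_pos hA.εg_pos 2)

/-- The accumulated decrease keeps the iterate in the level set, and this is what the next line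
search needs in order to terminate. In a stopped state one call is discounted, since the call that
returns the certificate produces no decrease. -/
theorem invariant_traj {Lg LH φlow : ℝ} (hA : P.Admissible) (hS : P.Smooth Lg LH)
    (hlow : IsLeast (range P.φ) φlow) {r : ℕ → Response n}
    (hr : ∀ k, P.Calls (P.traj r k) → P.ValidDirection (P.traj r k) (r k)) (m : ℕ) :
    P.Invariant Lg LH φlow (P.callCount r m) (P.proxCount r m) (P.traj r m) := by
  have hnc := ncDecrease_pos hA hS.LH_pos
  have hpg := proxDecrease_pos (Lg := Lg) hA
  have hlevel : ∀ {y : E n} {a b : ℕ},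
      P.ncDecrease LH * a + P.proxDecrease Lg * b ≤ P.φ P.x0 - P.φ y → y ∈ P.levelSet := by
    intro y a b h
    have := mul_nonneg hnc.le (Nat.cast_nonneg (α := ℝ) a)
    have := mul_nonneg hpg.le (Nat.cast_nonneg (α := ℝ) b)
    change P.φ y ≤ P.φ P.x0
    linarith
  induction m with
  | zero => simp [Invariant, traj, callCount, proxCount, levelSet, one_le_tmax]
  | succ m ih =>
    have hv := hr m
    rw [traj, callCount, proxCount, Nat.count_succ, Nat.count_succ]
    change P.Invariant Lg LH φlow (P.callCount r m + _) (P.proxCount r m + _) _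
    revert ih hv
    generalize P.traj r m = S
    generalize P.callCount r m = a
    generalize P.proxCount r m = b
    intro ih hv
    match S with
    | .diverged => exact ih.elim
    | .stopped x => simpa [Calls, ProxPhase, step] using ih
    | .running x t =>
      obtain ⟨hx, ht, htT, hφ⟩ := ih
      have hcall : P.Calls (.running x t) ↔ ‖P.G t x‖ ≤ P.εg := Iff.rfl
      have hprox : P.ProxPhase (.running x t) ↔ P.εg < ‖P.G t x‖ := Iff.rfl
      by_cases h : P.εg < ‖P.G t x‖
      · obtain ⟨j, hj, hjT, hdec⟩ := exists_proxStep hA hS hx ht htT h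
        rw [(step_of_lt h hj).1, if_pos (hprox.2 h), if_neg fun hc => (hcall.1 hc).not_gt h]
        have hφ' : P.ncDecrease LH * (a + 0 : ℕ) + P.proxDecrease Lg * (b + 1 : ℕ) ≤
            P.φ P.x0 - P.φ (P.proxPoint (P.β ^ j) x) := by
          rw [← proxDecrease] at hdec
          push_cast
          linarith
        exact ⟨hlevel hφ', pow_pos (zero_lt_one.trans hA.one_lt_β) j, hjT, hφ'⟩
      · have hle := not_lt.1 h
        rw [if_neg fun hc => h (hprox.1 hc), if_pos (hcall.2 hle)]
        rcases hu : (r m).vec with _ | u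
        · rw [step_of_le_of_none hle hu]
          refine ⟨⟨t, ht, hle⟩, ?_⟩
          have := hlow.2 (mem_range_self x)
          push_cast
          linarith
        · obtain ⟨hu1, hu2⟩ := hv hle u hu
          obtain ⟨j, hj, hdec⟩ := exists_ncStep hA hS hx hu1 hu2
          rw [step_of_le_of_some hle hu hj]
          have hφ' : P.ncDecrease LH * (a + 1 : ℕ) + P.proxDecrease Lg * (b + 0 : ℕ) ≤
              P.φ P.x0 - P.φ (P.ncPoint x u (P.θ ^ j)) := by
            rw [← ncDecrease] at hdec
            push_cast
            linarith
          exact ⟨hlevel hφ', pow_pos hA.θ_pos j,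
            (pow_le_one₀ hA.θ_pos.le hA.θ_lt.le).trans (one_le_tmax Lg), hφ'⟩

/-- While the algorithm runs, each iteration calls the oracle or takes a proximal step. -/
theorem callCount_add_proxCount {r : ℕ → Response n} (m : ℕ) {x : E n} {t : ℝ}
    (h : P.traj r m = .running x t) : P.callCount r m + P.proxCount r m = m := by
  induction m generalizing x t with
  | zero => simp [callCount, proxCount]
  | succ m ih =>
    rw [callCount, proxCount, Nat.count_succ, Nat.count_succ]
    change P.callCount r m + _ + (P.proxCount r m + _) = _
    rw [traj] at h
    match hS : P.traj r m with
    | .diverged => simp [hS, step] at h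
    | .stopped y => simp [hS, step] at h
    | .running y s =>
      have := ih hS
      have hcall : P.Calls (.running y s) ↔ ‖P.G s y‖ ≤ P.εg := Iff.rfl
      have hprox : P.ProxPhase (.running y s) ↔ P.εg < ‖P.G s y‖ := Iff.rfl
      rcases lt_or_ge P.εg ‖P.G s y‖ with h' | h'
      · rw [if_neg fun hc => (hcall.1 hc).not_gt h', if_pos (hprox.2 h')]; omega
      · rw [if_pos (hcall.2 h'), if_neg fun hc => (hprox.1 hc).not_ge h']; omega

/-- The algorithm stops only upon a certificate at the output. -/
theorem exists_certificate {r : ℕ → Response n} (m : ℕ) {x : E n}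
    (h : P.traj r m = .stopped x) :
    ∃ k < m, ∃ t, P.traj r k = .running x t ∧ ‖P.G t x‖ ≤ P.εg ∧ (r k).vec = none := by
  induction m generalizing x with
  | zero => simp [traj] at h
  | succ m ih =>
    match hS : P.traj r m with
    | .diverged => simp [traj, hS, step] at h
    | .stopped y =>
      have hy : y = x := by simpa [traj, hS, step] using h
      obtain ⟨k, hk, h'⟩ := ih (hy ▸ hS)
      exact ⟨k, hk.trans m.lt_succ_self, h'⟩
    | .running y t =>
      refine ⟨m, m.lt_succ_self, t, ?_⟩
      rw [traj, hS] at h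
      simp only [step] at h
      split_ifs at h with hG
      · split at h <;> simp at h
      · split at h
        · next hu => cases h; exact ⟨hS, not_lt.1 hG, hu⟩
        · split at h <;> simp at h

theorem traj_stopped_of_le {r : ℕ → Response n} {m m' : ℕ} {x : E n}
    (h : P.traj r m = .stopped x) (hm : m ≤ m') : P.traj r m' = .stopped x := by
  induction m', hm using Nat.le_induction with
  | base => exact h
  | succ k _ ih => rw [traj, ih, step]

/-- The factor `max {εg⁻¹ εh⁻¹, εh⁻³, εg⁻²}`. -/
noncomputable def rate (P : Setup n) : ℝ :=
  max (max (P.εg⁻¹ * P.εh⁻¹) ((P.εh ^ 3)⁻¹)) ((P.εg ^ 2)⁻¹)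

theorem one_le_rate (hA : P.Admissible) : 1 ≤ P.rate :=
  le_max_of_le_right ((one_le_inv₀ (pow_pos hA.εg_pos 2)).2 (pow_le_one₀ hA.εg_pos.le hA.εg_lt.le))

theorem inv_min_le_rate (hA : P.Admissible) : (min (P.εg * P.εh) (P.εh ^ 3))⁻¹ ≤ P.rate := by
  have h1 := hA.εg_pos
  have h2 := hA.εh_pos
  rcases min_choice (P.εg * P.εh) (P.εh ^ 3) with h | h <;> rw [h]
  · rw [mul_inv]; exact le_max_of_le_left (le_max_left _ _)
  · exact le_max_of_le_left (le_max_right _ _)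

theorem minConst_pos {Lg LH : ℝ} (hA : P.Admissible) (hLH : 0 < LH) :
    0 < min (P.cnc LH / 8) (P.cpg Lg) :=
  lt_min (div_pos (cnc_pos hA hLH) (by norm_num)) (cpg_pos hA)

theorem ratio_nonneg {Lg LH φlow : ℝ} (hA : P.Admissible) (hLH : 0 < LH)
    (hlow : IsLeast (range P.φ) φlow) : 0 ≤ P.ratio Lg LH φlow :=
  div_nonneg (sub_nonneg.2 (hlow.2 (mem_range_self _))) (minConst_pos hA hLH).le

theorem K_eq (Lg LH φlow : ℝ) : P.K Lg LH φlow = ⌈P.ratio Lg LH φlow * P.rate⌉₊ + 1 := rfl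

/-- Bounds on the numbers of oracle calls and of proximal gradient steps. -/
theorem count_le {Lg LH φlow : ℝ} (hA : P.Admissible) (hS : P.Smooth Lg LH)
    (hlow : IsLeast (range P.φ) φlow) {r : ℕ → Response n}
    (hr : ∀ k, P.Calls (P.traj r k) → P.ValidDirection (P.traj r k) (r k)) (m : ℕ) :
    P.callCount r m ≤ P.K Lg LH φlow ∧
      (P.proxCount r m : ℝ) ≤ P.tmax Lg * P.K Lg LH φlow := by
  have hnc := ncDecrease_pos hA hS.LH_pos
  have hpg := proxDecrease_pos (Lg := Lg) hA
  have hT : 0 < P.tmax Lg := zero_lt_one.trans_le (one_le_tmax Lg)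
  have hmc := minConst_pos (Lg := Lg) hA hS.LH_pos
  have hρ := ratio_nonneg (Lg := Lg) hA hS.LH_pos hlow
  have hεg := pow_pos hA.εg_pos 2
  have hmin : 0 < min (P.εg * P.εh) (P.εh ^ 3) :=
    lt_min (mul_pos hA.εg_pos hA.εh_pos) (pow_pos hA.εh_pos 3)
  set Δ := P.φ P.x0 - φlow with hΔ
  have hΔ0 : 0 ≤ Δ := sub_nonneg.2 (hlow.2 (mem_range_self _))
  have hinv : P.ncDecrease LH * ((P.callCount r m : ℝ) - 1) +
      P.proxDecrease Lg * P.proxCount r m ≤ Δ ∧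
      P.proxDecrease Lg * P.proxCount r m ≤ Δ := by
    have hi := invariant_traj hA hS hlow hr m
    have hc := mul_nonneg hnc.le (Nat.cast_nonneg (α := ℝ) (P.callCount r m))
    match hSt : P.traj r m with
    | .diverged => rw [hSt] at hi; exact hi.elim
    | .running x t =>
      rw [hSt] at hi
      have h1 := hi.2.2.2
      have h2 := hlow.2 (mem_range_self x)
      constructor <;> linarith
    | .stopped x =>
      rw [hSt] at hi
      refine ⟨hi.2, ?_⟩
      obtain ⟨k, hk, t, hkx, hG, -⟩ := exists_certificate m hSt
      -- The certificate came from a call, so the discounted count is nonnegative and can be dropped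
      -- from the bound on proximal steps.
      have h1 : (1 : ℝ) ≤ P.callCount r m := by
        have : P.callCount r (k + 1) ≤ P.callCount r m := by
          classical exact Nat.count_monotone _ hk
        have h2 : 1 ≤ P.callCount r (k + 1) := by
          have hc : P.Calls (P.traj r k) := by rw [hkx]; exact hG
          simp [callCount, Nat.count_succ, hc]
        exact_mod_cast h2.trans this
      have h3 := mul_nonneg hnc.le (sub_nonneg.2 h1)
      linarith [hi.2]
  have hΔρ : Δ = P.ratio Lg LH φlow * min (P.cnc LH / 8) (P.cpg Lg) := by
    rw [ratio, div_mul_cancel₀ _ hmc.ne']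
  have hceil : P.ratio Lg LH φlow * P.rate ≤ (⌈P.ratio Lg LH φlow * P.rate⌉₊ : ℝ) :=
    Nat.le_ceil _
  constructor
  · have h1 : (P.callCount r m : ℝ) - 1 ≤ P.ratio Lg LH φlow * P.rate := by
      have h2 : P.ncDecrease LH * ((P.callCount r m : ℝ) - 1) ≤ Δ := by
        linarith [hinv.1, mul_nonneg hpg.le (Nat.cast_nonneg (α := ℝ) (P.proxCount r m))]
      refine le_trans ((le_div_iff₀' hnc).2 h2) ?_
      rw [div_le_iff₀ hnc, hΔρ, ncDecrease]
      have h3 : 1 ≤ P.rate * min (P.εg * P.εh) (P.εh ^ 3) := by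
        have := mul_le_mul_of_nonneg_right (inv_min_le_rate hA) hmin.le
        rwa [inv_mul_cancel₀ hmin.ne'] at this
      have hc8 : 0 < P.cnc LH / 8 := hmc.trans_le (min_le_left _ _)
      calc P.ratio Lg LH φlow * min (P.cnc LH / 8) (P.cpg Lg)
          ≤ P.ratio Lg LH φlow * (P.cnc LH / 8) :=
            mul_le_mul_of_nonneg_left (min_le_left _ _) hρ
        _ ≤ P.ratio Lg LH φlow * (P.cnc LH / 8) *
            (P.rate * min (P.εg * P.εh) (P.εh ^ 3)) :=
            le_mul_of_one_le_right (mul_nonneg hρ hc8.le) h3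
        _ = _ := by ring
    -- The discounted final call is the +1 in K.
    have h4 : (P.callCount r m : ℝ) ≤ (P.K Lg LH φlow : ℕ) := by
      rw [K_eq]; push_cast; linarith
    exact_mod_cast h4
  · have h1 : P.tmax Lg * (P.ratio Lg LH φlow * P.rate) ≤ P.tmax Lg * P.K Lg LH φlow := by
      refine mul_le_mul_of_nonneg_left ?_ hT.le
      rw [K_eq]; push_cast; linarith
    refine le_trans ((le_div_iff₀' hpg).2 hinv.2) (le_trans ?_ h1)
    rw [div_le_iff₀ hpg, hΔρ, proxDecrease]
    have h3 : 1 ≤ P.rate * P.εg ^ 2 := by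
      have := mul_le_mul_of_nonneg_right (le_max_right _ _ : (P.εg ^ 2)⁻¹ ≤ P.rate) hεg.le
      rwa [inv_mul_cancel₀ hεg.ne'] at this
    calc P.ratio Lg LH φlow * min (P.cnc LH / 8) (P.cpg Lg)
        ≤ P.ratio Lg LH φlow * P.cpg Lg := mul_le_mul_of_nonneg_left (min_le_right _ _) hρ
      _ ≤ P.ratio Lg LH φlow * P.cpg Lg * (P.rate * P.εg ^ 2) :=
          le_mul_of_one_le_right (mul_nonneg hρ (cpg_pos hA).le) h3
      _ = _ := by field_simp

/-- Every run on which the returned directions are valid stops at a first-order point, after a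
number of iterations that does not depend on the run. -/
theorem exists_stopped {Lg LH φlow : ℝ} (hA : P.Admissible) (hS : P.Smooth Lg LH)
    (hlow : IsLeast (range P.φ) φlow) {r : ℕ → Response n}
    (hr : ∀ k, P.Calls (P.traj r k) → P.ValidDirection (P.traj r k) (r k)) :
    ∃ x, P.traj r (⌊(1 + P.tmax Lg) * P.K Lg LH φlow⌋₊ + 1) = .stopped x ∧
      P.StrongFirstOrder x := by
  have hi := invariant_traj hA hS hlow hr (⌊(1 + P.tmax Lg) * P.K Lg LH φlow⌋₊ + 1)
  match hSt : P.traj r (⌊(1 + P.tmax Lg) * P.K Lg LH φlow⌋₊ + 1) with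
  | .diverged => rw [hSt] at hi; exact hi.elim
  | .stopped x => rw [hSt] at hi; exact ⟨x, rfl, hi.1⟩
  | .running x t =>
    have h1 := callCount_add_proxCount _ hSt
    obtain ⟨h2, h3⟩ := count_le hA hS hlow hr (⌊(1 + P.tmax Lg) * P.K Lg LH φlow⌋₊ + 1)
    have h4 := Nat.lt_floor_add_one ((1 + P.tmax Lg) * (P.K Lg LH φlow : ℝ))
    have h5 : ((P.callCount r (⌊(1 + P.tmax Lg) * P.K Lg LH φlow⌋₊ + 1) : ℕ) : ℝ) ≤
      P.K Lg LH φlow := by exact_mod_cast h2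
    have h6 := congrArg (Nat.cast : ℕ → ℝ) h1
    push_cast at h6
    linarith

/-- The operations of the first `m` iterations, on a run with at most `N` Hessian-vector products
in each of these calls. -/
theorem sum_cost_le {Lg LH φlow : ℝ} (hA : P.Admissible) (hS : P.Smooth Lg LH)
    (hlow : IsLeast (range P.φ) φlow) {r : ℕ → Response n}
    (hr : ∀ k, P.Calls (P.traj r k) → P.ValidDirection (P.traj r k) (r k)) {N : ℕ} (m : ℕ)
    (hN : ∀ k < m, P.Calls (P.traj r k) → (r k).hvp ≤ N) :
    ((∑ k ∈ Finset.range m, P.cost (P.traj r k) (r k) : ℕ) : ℝ) ≤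
      (2 + Real.log (P.tmax Lg) / Real.log P.β) * P.proxCount r m +
        (1 + N : ℝ) * P.callCount r m := by
  induction m with
  | zero => simp [proxCount, callCount]
  | succ m ih =>
    have ih' := ih fun k hk => hN k (hk.trans m.lt_succ_self)
    have hN' := hN m m.lt_succ_self
    have hi := invariant_traj hA hS hlow hr m
    rw [Finset.sum_range_succ, callCount, proxCount, Nat.count_succ, Nat.count_succ]
    change _ ≤ _ * ((P.proxCount r m + _ : ℕ) : ℝ) + _ * ((P.callCount r m + _ : ℕ) : ℝ)
    match hSt : P.traj r m with
    | .diverged => simpa [Calls, ProxPhase, cost] using ih'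
    | .stopped x => simpa [Calls, ProxPhase, cost] using ih'
    | .running x t =>
      rw [hSt] at hi hN'
      have hcall : P.Calls (.running x t) ↔ ‖P.G t x‖ ≤ P.εg := Iff.rfl
      have hprox : P.ProxPhase (.running x t) ↔ P.εg < ‖P.G t x‖ := Iff.rfl
      by_cases h : P.εg < ‖P.G t x‖
      · obtain ⟨j, hj, hjT, -⟩ := exists_proxStep hA hS hi.1 hi.2.1 hi.2.2.1 h
        rw [if_pos (hprox.2 h), if_neg fun hc => (hcall.1 hc).not_gt h, (step_of_lt h hj).2]
        have hlog := Real.log_pos hA.one_lt_β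
        -- A proximal iteration costs 2 + j, and β^j ≤ T bounds j by log T / log β.
        have hj' : (j : ℝ) ≤ Real.log (P.tmax Lg) / Real.log P.β := by
          rw [le_div_iff₀ hlog, ← Real.log_pow]
          exact Real.log_le_log (pow_pos (zero_lt_one.trans hA.one_lt_β) j) hjT
        push_cast at ih' ⊢
        linarith
      · have hle := not_lt.1 h
        rw [if_neg fun hc => h (hprox.1 hc), if_pos (hcall.2 hle), cost_of_le hle]
        have : ((r m).hvp : ℝ) ≤ N := by exact_mod_cast hN' hle
        push_cast at ih' ⊢
        linarith

end Setup

/-- The constant of the operation bound. -/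
noncomputable def opConst (Lg β ηbar A σbar : ℝ) : ℝ :=
  (2 + Real.log (max (β * Lg / (2 - 2 * ηbar)) 1) / Real.log β) *
      max (β * Lg / (2 - 2 * ηbar)) 1 * (1 + (-Real.log σbar)⁻¹) +
    (1 + (-Real.log σbar)⁻¹) + (1 + (2 + |A|) * (-Real.log σbar)⁻¹ + |A|)

theorem ProbGE.mono {Ω : Type*} {mΩ : MeasurableSpace Ω} {μ : Measure Ω} {S S' : Set Ω} {p : ℝ}
    (h : ProbGE μ S p) (hS : S ⊆ S') : ProbGE μ S' p :=
  h.imp fun _ hT => ⟨hT.1, hT.2.1.trans hS, hT.2.2⟩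

namespace Setup

variable {n : ℕ} {P : Setup n}

theorem success_mono {Ω : Type*} (R : ℕ → Ω → Response n) {B B' : ℝ} (h : B ≤ B') :
    P.success R B ⊆ P.success R B' := by
  rintro ω ⟨x, ⟨m, hm, hB⟩, hx⟩
  exact ⟨x, ⟨m, hm, hB.trans h⟩, hx⟩

/-! ### Operation bounds in terms of `work` and of powers of the tolerances -/

section Work

variable {A σbar σ Cmeo : ℝ}

theorem one_le_rpow_εh (hA : P.Admissible) : 1 ≤ P.εh ^ (-(1 / 2) : ℝ) :=
  Real.one_le_rpow_of_pos_of_le_one_of_nonpos hA.εh_pos hA.εh_lt.le (by norm_num)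

theorem neg_log_nonneg (h0 : 0 ≤ σ) (h : σ ≤ σbar) (h1 : σbar < 1) : 0 ≤ -Real.log σbar :=
  neg_nonneg.2 (Real.log_nonpos (h0.trans h) h1.le)

theorem neg_log_pos (h0 : 0 < σ) (h : σ ≤ σbar) (h1 : σbar < 1) : 0 < -Real.log σbar :=
  neg_pos.2 (Real.log_neg (h0.trans_le h) h1)

theorem neg_log_le_log_div (hn : 0 < n) (h0 : 0 < σ) (h : σ ≤ σbar) :
    -Real.log σbar ≤ Real.log (n / σ) := by
  have hn' : (1 : ℝ) ≤ n := by exact_mod_cast hn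
  rw [Real.log_div (by positivity) h0.ne']
  linarith [Real.log_nonneg hn', Real.log_le_log h0 h]

/-- Absorbs costs independent of the oracle into multiples of `work`. For σ > 0 it rests on log(n/σ)
≥ −log σbar > 0, which is why C depends on σbar. For σ = 0 it is n ≥ 1, which also covers σbar = 0,
where Lean's `Real.log 0 = 0` makes the inverse zero. -/
theorem one_le_mul_work (hA : P.Admissible) (hn : 0 < n) (h0 : 0 ≤ σ) (h : σ ≤ σbar)
    (h1 : σbar < 1) : 1 ≤ (1 + (-Real.log σbar)⁻¹) * P.work σ := by
  have hn' : (1 : ℝ) ≤ n := by exact_mod_cast hn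
  have hi := inv_nonneg.2 (neg_log_nonneg h0 h h1)
  unfold work
  split_ifs with hσ
  · nlinarith
  · have h0' := h0.lt_of_ne' hσ
    have hl := neg_log_pos h0' h h1
    have hL := neg_log_le_log_div (n := n) hn h0' h
    have he := P.one_le_rpow_εh hA
    rcases min_choice (n : ℝ) (P.εh ^ (-(1 / 2) : ℝ) * Real.log (n / σ)) with hm | hm <;> rw [hm]
    · nlinarith
    · have h2 : -Real.log σbar ≤ P.εh ^ (-(1 / 2) : ℝ) * Real.log (n / σ) := by nlinarith
      have h3 := mul_le_mul_of_nonneg_left h2 hi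
      rw [inv_mul_cancel₀ hl.ne'] at h3
      linarith

theorem meoBound_le (hA : P.Admissible) (hn : 0 < n) (h0 : 0 ≤ σ) (h : σ ≤ σbar) (h1 : σbar < 1)
    (hC : 0 < σ → Cmeo ≤ A * (1 + Real.log (n / σ))) :
    (P.meoBound Cmeo : ℝ) ≤ (1 + (2 + |A|) * (-Real.log σbar)⁻¹ + |A|) * P.work σ := by
  have hi := inv_nonneg.2 (neg_log_nonneg h0 h h1)
  have hA0 := abs_nonneg A
  have hc : 1 ≤ 1 + (2 + |A|) * (-Real.log σbar)⁻¹ + |A| := by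
    linarith [mul_nonneg (add_nonneg zero_le_two hA0) hi]
  have hn0 : (0 : ℝ) ≤ n := n.cast_nonneg
  have hNn : (P.meoBound Cmeo : ℝ) ≤
      (1 + (2 + |A|) * (-Real.log σbar)⁻¹ + |A|) * n := by
    have : (P.meoBound Cmeo : ℝ) ≤ n := by exact_mod_cast min_le_left _ _
    exact this.trans (le_mul_of_one_le_left hn0 hc)
  unfold work
  split_ifs with hσ
  · exact hNn
  · have h0' := h0.lt_of_ne' hσ
    have hl := neg_log_pos h0' h h1
    have hL := neg_log_le_log_div (n := n) hn h0' h
    have he := P.one_le_rpow_εh hA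
    rw [mul_min_of_nonneg _ _ (zero_le_one.trans hc)]
    refine le_min hNn ?_
    set e := P.εh ^ (-(1 / 2) : ℝ) with he_def
    set L := Real.log (n / σ)
    have hL0 : 0 ≤ L := hl.le.trans hL
    have h2 : Cmeo * e ≤ |A| * (1 + L) * e := by
      refine mul_le_mul_of_nonneg_right ((hC h0').trans ?_) (zero_le_one.trans he)
      exact mul_le_mul_of_nonneg_right (le_abs_self A) (by linarith)
    -- The bound with |A| is nonnegative, so the ceiling adds at most 1. The constants 1 + 1 and
    -- |A|e are then absorbed into e·L through 1 ≤ (−log σbar)⁻¹·L.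
    have h3 : (⌈Cmeo * e⌉₊ : ℝ) ≤ |A| * (1 + L) * e + 1 :=
      (Nat.cast_le.2 (Nat.ceil_mono h2)).trans (Nat.ceil_lt_add_one (by positivity)).le
    have h4 : (P.meoBound Cmeo : ℝ) ≤ 1 + (⌈Cmeo * e⌉₊ : ℝ) := by
      exact_mod_cast min_le_right _ _
    have h5 : 1 ≤ (-Real.log σbar)⁻¹ * L := by
      have := mul_le_mul_of_nonneg_left hL hi
      rwa [inv_mul_cancel₀ hl.ne'] at this
    have h6 : 1 ≤ (-Real.log σbar)⁻¹ * L * e := one_le_mul_of_one_le_of_one_le h5 he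
    have h7 : |A| * e ≤ |A| * e * ((-Real.log σbar)⁻¹ * L) :=
      le_mul_of_one_le_right (by positivity) h5
    have h8 : 0 ≤ e * L := by positivity
    linarith

theorem opConst_nonneg {Lg : ℝ} (hA : P.Admissible) (h0 : 0 ≤ σ) (h : σ ≤ σbar)
    (h1 : σbar < 1) : 0 ≤ opConst Lg P.β P.ηbar A σbar := by
  have hi := inv_nonneg.2 (neg_log_nonneg h0 h h1)
  have hlog := Real.log_pos hA.one_lt_β
  have hT : 1 ≤ max (P.β * Lg / (2 - 2 * P.ηbar)) 1 := le_max_right _ _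
  have hlT := Real.log_nonneg hT
  unfold opConst
  positivity

theorem work_nonneg (hA : P.Admissible) (hn : 0 < n) (h0 : 0 ≤ σ) (h : σ ≤ σbar)
    (h1 : σbar < 1) : 0 ≤ P.work σ := by
  have hi := inv_nonneg.2 (neg_log_nonneg h0 h h1)
  have := one_le_mul_work hA hn h0 h h1
  by_contra! hlt
  nlinarith

/-- The operation bound for runs on which the oracle keeps its budget. -/
theorem sum_cost_le_opConst {Lg LH φlow : ℝ} (hA : P.Admissible) (hS : P.Smooth Lg LH)
    (hlow : IsLeast (range P.φ) φlow) (hn : 0 < n) (h0 : 0 ≤ σ) (h : σ ≤ σbar) (h1 : σbar < 1)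
    (hC : 0 < σ → Cmeo ≤ A * (1 + Real.log (n / σ))) {r : ℕ → Response n}
    (hr : ∀ k, P.Calls (P.traj r k) → P.ValidDirection (P.traj r k) (r k)) (m : ℕ)
    (hN : ∀ k < m, P.Calls (P.traj r k) → (r k).hvp ≤ P.meoBound Cmeo) :
    ((∑ k ∈ Finset.range m, P.cost (P.traj r k) (r k) : ℕ) : ℝ) ≤
      opConst Lg P.β P.ηbar A σbar * P.K Lg LH φlow * P.work σ := by
  refine (sum_cost_le hA hS hlow hr m hN).trans ?_
  obtain ⟨hc, hp⟩ := count_le hA hS hlow hr m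
  have hc' : (P.callCount r m : ℝ) ≤ P.K Lg LH φlow := by exact_mod_cast hc
  have hW := one_le_mul_work (P := P) hA hn h0 h h1
  have hNW := meoBound_le (P := P) hA hn h0 h h1 hC
  have hT := one_le_tmax (P := P) Lg
  have hJ : 0 ≤ 2 + Real.log (P.tmax Lg) / Real.log P.β :=
    add_nonneg zero_le_two (div_nonneg (Real.log_nonneg hT) (Real.log_pos hA.one_lt_β).le)
  have hK : (0 : ℝ) ≤ P.K Lg LH φlow := Nat.cast_nonneg _
  -- The three summands of `opConst` pay for the proximal iterations, the single evaluation of the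
  -- test at each oracle call, and the Hessian-vector products.
  have e1 := mul_le_mul_of_nonneg_left hp hJ
  have e2 : (1 + (P.meoBound Cmeo : ℝ)) * P.callCount r m ≤
      (1 + (P.meoBound Cmeo : ℝ)) * P.K Lg LH φlow :=
    mul_le_mul_of_nonneg_left hc' (by positivity)
  have e3 := mul_le_mul_of_nonneg_left hW
    (mul_nonneg hJ (mul_nonneg (zero_le_one.trans hT) hK))
  have e4 := mul_le_mul_of_nonneg_left (add_le_add hW hNW) hK
  have e5 : opConst Lg P.β P.ηbar A σbar =
    (2 + Real.log (P.tmax Lg) / Real.log P.β) * P.tmax Lg * (1 + (-Real.log σbar)⁻¹) +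
    (1 + (-Real.log σbar)⁻¹) + (1 + (2 + |A|) * (-Real.log σbar)⁻¹ + |A|) := rfl
  rw [e5]
  linarith

theorem work_le (hσ : 0 < σ) : P.work σ ≤ P.εh ^ (-(1 / 2) : ℝ) * Real.log (n / σ) := by
  rw [work, if_neg hσ.ne']
  exact min_le_right _ _

theorem K_le {Lg LH φlow : ℝ} (hA : P.Admissible) (hLH : 0 < LH)
    (hlow : IsLeast (range P.φ) φlow) :
    (P.K Lg LH φlow : ℝ) ≤ 2 * (1 + P.ratio Lg LH φlow) * P.rate := by
  have hρ := ratio_nonneg (Lg := Lg) hA hLH hlow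
  have hr := one_le_rate hA
  have hρr := mul_nonneg hρ (zero_le_one.trans hr)
  have := (Nat.ceil_lt_add_one hρr).le
  rw [K_eq]
  push_cast
  linarith

/-- The complexity factor of the first corollary. -/
theorem rate_mul_rpow (hA : P.Admissible) :
    P.rate * P.εh ^ (-(1 / 2) : ℝ) =
      max (max (P.εg ^ (-1 : ℝ) * P.εh ^ (-(3 / 2) : ℝ)) (P.εh ^ (-(7 / 2) : ℝ)))
        (P.εg ^ (-2 : ℝ) * P.εh ^ (-(1 / 2) : ℝ)) := by
  have hg := hA.εg_pos
  have hh := hA.εh_pos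
  have e1 : P.εh⁻¹ = P.εh ^ (-1 : ℝ) := (Real.rpow_neg_one _).symm
  have e2 : (P.εh ^ 3)⁻¹ = P.εh ^ (-3 : ℝ) := by
    rw [Real.rpow_neg hh.le]; norm_cast
  have e3 : (P.εg ^ 2)⁻¹ = P.εg ^ (-2 : ℝ) := by
    rw [Real.rpow_neg hg.le]; norm_cast
  have e4 : P.εg⁻¹ = P.εg ^ (-1 : ℝ) := (Real.rpow_neg_one _).symm
  have hp : 0 ≤ P.εh ^ (-(1 / 2) : ℝ) := Real.rpow_nonneg hh.le _
  rw [rate, max_mul_of_nonneg _ _ hp, max_mul_of_nonneg _ _ hp, e1, e2, e3, e4, mul_assoc,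
    ← Real.rpow_add hh, ← Real.rpow_add hh]
  norm_num

/-- The exponents are −1 − 3ν/2, −7ν/2 and −2 − ν/2. The last dominates the first if ν ≤ 1 and the
second exactly if ν ≤ 2/3. -/
theorem rate_mul_rpow_le (hA : P.Admissible) {ν : ℝ} (hν : 0 < ν) (hν' : ν ≤ 2 / 3)
    (h : P.εh = P.εg ^ ν) :
    P.rate * P.εh ^ (-(1 / 2) : ℝ) ≤ P.εg ^ (-(2 + ν / 2) : ℝ) := by
  have hg := hA.εg_pos
  have hmono : ∀ {a b : ℝ}, b ≤ a → P.εg ^ a ≤ P.εg ^ b := fun hab =>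
    Real.rpow_le_rpow_of_exponent_ge hg hA.εg_lt.le hab
  rw [rate_mul_rpow hA, h, ← Real.rpow_mul hg.le, ← Real.rpow_mul hg.le, ← Real.rpow_mul hg.le,
    ← Real.rpow_add hg, ← Real.rpow_add hg]
  refine max_le (max_le (hmono ?_) (hmono ?_)) (hmono ?_) <;> linarith

theorem opConst_mul_K_mul_work_le {Lg LH φlow : ℝ} (hA : P.Admissible) (hLH : 0 < LH)
    (hlow : IsLeast (range P.φ) φlow) (hn : 0 < n) (h0 : 0 < σ) (h : σ ≤ σbar) (h1 : σbar < 1)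
    {B : ℝ} (hB : P.rate * P.εh ^ (-(1 / 2) : ℝ) ≤ B) :
    opConst Lg P.β P.ηbar A σbar * P.K Lg LH φlow * P.work σ ≤
      2 * opConst Lg P.β P.ηbar A σbar * (1 + P.ratio Lg LH φlow) * Real.log (n / σ) * B := by
  have hc := opConst_nonneg (P := P) (A := A) (Lg := Lg) hA h0.le h h1
  have hρ := ratio_nonneg (Lg := Lg) hA hLH hlow
  have hL : 0 ≤ Real.log (n / σ) :=
    (neg_log_pos h0 h h1).le.trans (neg_log_le_log_div (n := n) hn h0 h)
  have hr := zero_le_one.trans (one_le_rate hA)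
  calc opConst Lg P.β P.ηbar A σbar * P.K Lg LH φlow * P.work σ
      ≤ opConst Lg P.β P.ηbar A σbar * (2 * (1 + P.ratio Lg LH φlow) * P.rate) *
          (P.εh ^ (-(1 / 2) : ℝ) * Real.log (n / σ)) :=
        mul_le_mul (mul_le_mul_of_nonneg_left (K_le hA hLH hlow) hc) (work_le h0)
          (work_nonneg hA hn h0.le h h1) (by positivity)
    _ = 2 * opConst Lg P.β P.ηbar A σbar * (1 + P.ratio Lg LH φlow) * Real.log (n / σ) *
          (P.rate * P.εh ^ (-(1 / 2) : ℝ)) := by ring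
    _ ≤ _ := mul_le_mul_of_nonneg_left hB (by positivity)

end Work

/-! ### The event that all oracle calls are good -/

section Oracle

variable {Ω : Type*} {mΩ : MeasurableSpace Ω} {μ : Measure Ω} {ℱ : Filtration ℕ mΩ}
  {R : ℕ → Ω → Response n} {σ Cmeo : ℝ}

/-- The event that all oracle calls of the first `m` iterations keep the budget and issue no wrong
certificate. -/
def oracleGood (P : Setup n) (R : ℕ → Ω → Response n) (Cmeo : ℝ) (m : ℕ) : Set Ω :=
  {ω | ∀ k < m, P.Calls (P.traj (R · ω) k) →
    (R k ω).hvp ≤ P.meoBound Cmeo ∧ P.CorrectCertificate (P.traj (R · ω) k) (R k ω)}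

theorem measurableSet_oracleGood (hM : P.MEOAssumption μ ℱ R σ Cmeo) (m : ℕ) :
    MeasurableSet (P.oracleGood R Cmeo m) := by
  have : P.oracleGood R Cmeo m = ⋂ k ∈ Iio m, ({ω | P.Calls (P.traj (R · ω) k)}ᶜ ∪
      {ω | P.Calls (P.traj (R · ω) k) ∧ (R k ω).hvp ≤ P.meoBound Cmeo ∧
        P.CorrectCertificate (P.traj (R · ω) k) (R k ω)}) := by
    ext ω
    simp only [oracleGood, mem_ofPred_eq, mem_iInter, mem_Iio, mem_union, mem_compl_iff]
    refine forall₂_congr fun k _ => ?_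
    tauto
  rw [this]
  exact MeasurableSet.biInter (to_countable _) fun k _ =>
    (ℱ.le k _ (hM.meas_calls k)).compl.union (ℱ.le (k + 1) _ (hM.meas_good k))

/-- The exponent counts calls, not iterations, so the pathwise bound `b` on calls enters and the
horizon `m` does not. -/
theorem pow_le_measureReal_oracleGood [IsProbabilityMeasure μ]
    (hM : P.MEOAssumption μ ℱ R σ Cmeo) (h0 : 0 ≤ σ) (h1 : σ ≤ 1) {m b : ℕ}
    (hb : ∀ ω, P.callCount (R · ω) m ≤ b) :
    (1 - σ) ^ b ≤ μ.real (P.oracleGood R Cmeo m) := by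
  have := pow_mul_measureReal_le μ ℱ hM.meas_calls hM.meas_good (sub_nonneg.2 h1)
    (sub_le_self 1 h0) hM.prob m 0 b univ MeasurableSet.univ fun ω _ => by
      have hω := hb ω
      unfold callCount at hω
      convert hω using 3 with k
      rw [zero_add, mem_ofPred_eq]
  simp only [probReal_univ, mul_one, univ_inter, zero_add] at this
  refine this.trans (measureReal_mono fun ω hω k hk hc => ?_)
  exact (hω k hk hc).2

end Oracle

end Setup

end HPGNCM

/-! ### Assembly of the complexity theorem -/

open HPGNCM Setup in
theorem mainTheorem6 :
    -- the hidden constant depends only on `Lg`, `β`, `ηbar`, `A` and `σbar`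
    ∃ C : ℝ → ℝ → ℝ → ℝ → ℝ → ℝ,
      ∀ (n : ℕ) (P : HPGNCM.Setup n) (Lg LH φlow A σbar σ Cmeo : ℝ)
        (Ω : Type*) (mΩ : MeasurableSpace Ω) (μ : MeasureTheory.Measure Ω)
        (ℱ : MeasureTheory.Filtration ℕ mΩ) (R : ℕ → Ω → HPGNCM.Response n),
        MeasureTheory.IsProbabilityMeasure μ →
        0 < n → P.Admissible → P.Smooth Lg LH → IsLeast (Set.range P.φ) φlow →
        0 ≤ σ → σ ≤ σbar → σbar < 1 →
        (0 < σ → Cmeo ≤ A * (1 + Real.log (n / σ))) →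
        P.MEOAssumption μ ℱ R σ Cmeo →
        -- correct termination within the operation bound
        HPGNCM.ProbGE μ (P.success R
          (C Lg P.β P.ηbar A σbar * P.K Lg LH φlow * P.work σ)) ((1 - σ) ^ P.K Lg LH φlow) ∧
        -- incorrect termination
        μ.real (P.incorrect R) ≤ 1 - (1 - σ) ^ P.K Lg LH φlow ∧
        -- termination with this complexity, correct or not, if the oracle keeps its budget
        (∀ ω, (∀ k, P.Calls (P.traj (R · ω) k) → (R k ω).hvp ≤ P.meoBound Cmeo) →
          ∃ x, P.StopsWithin (R · ω)
            (C Lg P.β P.ηbar A σbar * P.K Lg LH φlow * P.work σ) x ∧ P.StrongFirstOrder x) ∧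
        (0 < σ →
          -- (i)
          HPGNCM.ProbGE μ (P.success R
            (C Lg P.β P.ηbar A σbar * (1 + P.ratio Lg LH φlow) * Real.log (n / σ) *
              max (max (P.εg ^ (-1 : ℝ) * P.εh ^ (-(3 / 2) : ℝ)) (P.εh ^ (-(7 / 2) : ℝ)))
                (P.εg ^ (-2 : ℝ) * P.εh ^ (-(1 / 2) : ℝ)))) ((1 - σ) ^ P.K Lg LH φlow) ∧
          -- (ii)
          (∀ ν : ℝ, 0 < ν → ν ≤ 2 / 3 → P.εh = P.εg ^ ν →
            HPGNCM.ProbGE μ (P.success R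
              (C Lg P.β P.ηbar A σbar * (1 + P.ratio Lg LH φlow) * Real.log (n / σ) *
                P.εg ^ (-(2 + ν / 2) : ℝ))) ((1 - σ) ^ P.K Lg LH φlow)) ∧
          -- (ii) with exponent one half
          (P.εh = P.εg ^ (1 / 2 : ℝ) →
            HPGNCM.ProbGE μ (P.success R
              (C Lg P.β P.ηbar A σbar * (1 + P.ratio Lg LH φlow) * Real.log (n / σ) *
                P.εg ^ (-(9 / 4) : ℝ))) ((1 - σ) ^ P.K Lg LH φlow))) := by
  -- The factor 2 comes from K ≤ 2(1 + ρ)·`rate` and is needed only for (i) and (ii).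
  refine ⟨fun Lg β ηbar A σbar => 2 * HPGNCM.opConst Lg β ηbar A σbar, ?_⟩
  intro n P Lg LH φlow A σbar σ Cmeo Ω mΩ μ ℱ R hμ hn hA hS hlow h0 h h1 hC hM
  have hvalid := fun ω k => hM.valid k ω
  -- A horizon by which every run has stopped, so a good event over finitely many calls suffices.
  set M := ⌊(1 + P.tmax Lg) * P.K Lg LH φlow⌋₊ + 1 with hMdef
  have hKW : 0 ≤ HPGNCM.opConst Lg P.β P.ηbar A σbar * P.K Lg LH φlow * P.work σ :=
    mul_nonneg (mul_nonneg (opConst_nonneg hA h0 h h1) (Nat.cast_nonneg _))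
      (work_nonneg hA hn h0 h h1)
  have hmeas := measurableSet_oracleGood hM M
  have hprob : (1 - σ) ^ P.K Lg LH φlow ≤ μ.real (P.oracleGood R Cmeo M) :=
    pow_le_measureReal_oracleGood hM h0 (h.trans h1.le)
      fun ω => (count_le hA hS hlow (hvalid ω) M).1
  have hstar : ∀ ω ∈ P.oracleGood R Cmeo M, ∀ m x, P.traj (R · ω) m = .stopped x →
      P.StrongStar x := by
    intro ω hω m x hx
    obtain ⟨y, hy, hy1⟩ := exists_stopped hA hS hlow (hvalid ω)
    rw [← hMdef] at hy
    -- Stopped states are absorbing, so the output at any time agrees with the one at the horizon.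
    have hxy : x = y := by
      have e1 := traj_stopped_of_le hx (le_max_left m M)
      have e2 := traj_stopped_of_le hy (le_max_right m M)
      rw [e1] at e2
      exact HPGNCM.State.stopped.inj e2
    subst hxy
    obtain ⟨k, hk, t, hkx, hG, hvec⟩ := exists_certificate M hy
    have hcall : P.Calls (P.traj (R · ω) k) := by rw [hkx]; exact hG
    have hcert := (hω k hk hcall).2
    rw [hkx] at hcert
    exact ⟨hy1, hcert hvec⟩
  have hmain : HPGNCM.ProbGE μ
      (P.success R (HPGNCM.opConst Lg P.β P.ηbar A σbar * P.K Lg LH φlow * P.work σ))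
      ((1 - σ) ^ P.K Lg LH φlow) := by
    refine ⟨P.oracleGood R Cmeo M, hmeas, fun ω hω => ?_, hprob⟩
    obtain ⟨x, hx, -⟩ := exists_stopped hA hS hlow (hvalid ω)
    exact ⟨x, ⟨M, hx, sum_cost_le_opConst hA hS hlow hn h0 h h1 hC (hvalid ω) M
      fun k hk hc => (hω k hk hc).1⟩, hstar ω hω M x hx⟩
  refine ⟨hmain.mono (success_mono R (by linarith)), ?_, fun ω hω => ?_, fun hσ => ⟨?_, ?_, ?_⟩⟩
  · have hsub : P.incorrect R ⊆ (P.oracleGood R Cmeo M)ᶜ := by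
      rintro ω ⟨x, B, ⟨m, hm, -⟩, -, hx⟩ hω
      exact hx (hstar ω hω m x hm)
    have := measureReal_mono (μ := μ) hsub
    rw [probReal_compl_eq_one_sub hmeas] at this
    linarith
  · obtain ⟨x, hx, hx1⟩ := exists_stopped hA hS hlow (hvalid ω)
    have := sum_cost_le_opConst hA hS hlow hn h0 h h1 hC (hvalid ω) M fun k _ => hω k
    exact ⟨x, ⟨M, hx, by linarith⟩, hx1⟩
  · exact hmain.mono (success_mono R
      (opConst_mul_K_mul_work_le hA hS.LH_pos hlow hn hσ h h1 (rate_mul_rpow hA).le))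
  · intro ν hν hν' hε
    exact hmain.mono (success_mono R
      (opConst_mul_K_mul_work_le hA hS.LH_pos hlow hn hσ h h1 (rate_mul_rpow_le hA hν hν' hε)))
  · intro hε
    have hrate := rate_mul_rpow_le hA (by norm_num) (by norm_num) hε
    norm_num only at hrate
    exact hmain.mono (success_mono R
      (opConst_mul_K_mul_work_le hA hS.LH_pos hlow hn hσ h h1 hrate))
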